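/- Let $\Omega\subset\mathbb R^m$ be a polyhedral domain with a simplicial triangulation $\mathcal T_h$ by finitely many $m$-simplices, and let $\mathcal E_h=\bigcup_{K\in\mathcal T_h}\partial K$. For each $K\in\mathcal T_h$ let $V(K)\subset[H^2(K)]^n$ and $\Sigma(K)\subset[H^1(K)]^{mn}$ be finite-dimensional subspaces, and let $V^*(K)$ be the dual of $V(K)$, realized by a subspace of $[L^2(K)]^n$ through the pairing $(r,v)\mapsto\int_K r_iv^i\,d^mx$ (sums over repeated indices $i=1,\dots,n$, $\mu=1,\dots,m$ are implied). Put $V=\prod_KV(K)$, $\Sigma=\prod_K\Sigma(K)$, $V^*=\prod_KV^*(K)$, and let $\widehat V$ be a subspace of $[L^2(\mathcal E_h)]^n$. Let $\Phi$ be a numerical flux function, determining $\widehat\sigma=\Phi(u,\sigma,\widehat u)\in\prod_K[L^2(\partial K)]^{mn}$ from $(u,\sigma,\widehat u)\in V\times\Sigma\times\widehat V$, and let $H=H(t,x,u,p,\sigma)$ be a Hamiltonian on $(t_0,t_1)\times\Omega\times\mathbb R^n\times\mathbb R^n\times\mathbb R^{mn}$ that is $C^2$ in $(u,p,\sigma)$.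 Write $d^{m-1}x_\mu=N_\mu\,dS$ on $\partial K$, with $N$ the outer unit normal and $dS$ the surface measure; on $\partial K$, functions in $H^1(K)$ are understood as traces. Fix $K\in\mathcal T_h$, and let $(u(t),\sigma(t),p(t),\widehat u(t))\in V\times\Sigma\times V^*\times\widehat V$, $t\in(t_0,t_1)$, satisfy the semidiscrete de Donder–Weyl equations on $K$: $$\int_K\dot u^ir_i\,d^mx=\int_K\frac{\partial H}{\partial p_i}r_i\,d^mx\quad\forall r\in V^*(K),$$ $$0=\int_K\Bigl(u^i\partial_\mu\tau_i^\mu+\frac{\partial H}{\partial\sigma_i^\mu}\tau_i^\mu\Bigr)d^mx-\int_{\partial K}\widehat u^i\tau_i^\mu\,d^{m-1}x_\mu\quad\forall\tau\in\Sigma(K),$$ $$\int_K\dot p_iv^i\,d^mx=\int_K\Bigl(\sigma_i^\mu\partial_\mu v^i-\frac{\partial H}{\partial u^i}v^i\Bigr)d^mx-\int_{\partial K}\widehat\sigma_i^\mu v^i\,d^{m-1}x_\mu\quad\forall v\in V(K),$$ where $u$ and $p$ are differentiable in time on $K$, all integrals exist, and $\Phi$ is differentiable at $(u(t),\sigma(t),\widehat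 u(t))$. A (first) variation of the solution on $K$ is a family $(v(t),\tau(t),r(t),\widehat v(t))\in V\times\Sigma\times V^*\times\widehat V$, with $v$ and $r$ differentiable in time on $K$, satisfying the linearization of these three equations: $u,\sigma,p,\widehat u$ are replaced by $v,\tau,r,\widehat v$; the first derivatives of $H$ are replaced by its Hessian in $(u,p,\sigma)$, evaluated at $(t,x,u,p,\sigma)$ and applied to $(v,r,\tau)$; $\widehat\sigma$ is replaced by $\widehat\tau=\Phi'(u,\sigma,\widehat u)(v,\tau,\widehat v)$; and all integrals exist. For two variations, $\mathrm du^i\wedge\mathrm dp_i$ denotes $v^ir_i'-v'^ir_i$, $\mathrm d\widehat u^i\wedge\mathrm d\widehat\sigma_i^\mu$ denotes $\widehat v^i\widehat\tau_i'^\mu-\widehat v'^i\widehat\tau_i^\mu$, and $\mathrm d(\widehat u^i-u^i)\wedge\mathrm d(\widehat\sigma_i^\mu-\sigma_i^\mu)$ denotes $(\widehat v^i-v^i)(\widehat\tau_i'^\mu-\tau_i'^\mu)-(\widehat v'^i-v'^i)(\widehat\tau_i^\mu-\tau_i^\mu)$. **Theorem.** For every pair of variations on $K$ and every $t\in(t_0,t_1)$,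 the density $\mathrm du^i\wedge\mathrm dp_i$ is differentiable in time (as a curve in $L^1(K)$), and $$\int_K\partial_t(\mathrm du^i\wedge\mathrm dp_i)\,d^mx=-\int_{\partial K}(\mathrm d\widehat u^i\wedge\mathrm d\widehat\sigma_i^\mu)\,d^{m-1}x_\mu+\int_{\partial K}\bigl(\mathrm d(\widehat u^i-u^i)\wedge\mathrm d(\widehat\sigma_i^\mu-\sigma_i^\mu)\bigr)\,d^{m-1}x_\mu.$$ Consequently, the semidiscrete multisymplectic conservation law $$\int_K\partial_t(\mathrm du^i\wedge\mathrm dp_i)\,d^mx=-\int_{\partial K}(\mathrm d\widehat u^i\wedge\mathrm d\widehat\sigma_i^\mu)\,d^{m-1}x_\mu$$ holds on $K$ if and only if $\int_{\partial K}\bigl(\mathrm d(\widehat u^i-u^i)\wedge\mathrm d(\widehat\sigma_i^\mu-\sigma_i^\mu)\bigr)\,d^{m-1}x_\mu=0$; this holds both for each pair of variations at each time, and for the statements asserted for all pairs of variations and all times. -/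

import Mathlib

open MeasureTheory Set Filter Topology
open scoped ContDiff

noncomputable section

namespace HybridDDW

/-- Space `ℝ^m`. -/
abbrev Space (m : ℕ) := EuclideanSpace ℝ (Fin m)

/-- Values of `u`, and of `p`: the component `u^i` is `u i`. -/
abbrev Fld (n : ℕ) := EuclideanSpace ℝ (Fin n)

/-- Values of `σ`: the component `σ_i^μ` is `σ (μ, i)`. -/
abbrev Flx (m n : ℕ) := EuclideanSpace ℝ (Fin m × Fin n)

/-- The space `ℝ^n × ℝ^n × ℝ^{mn}` of values of `(u, p, σ)`. -/
abbrev Phase (m n : ℕ) := Fld n × Fld n × Flx m n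

/-! ### Measures, normals and Sobolev spaces on a convex body `K` -/

/-- Lebesgue measure on `K`. -/
abbrev vol {m : ℕ} (K : Set (Space m)) : Measure (Space m) := volume.restrict K

/-- `(m-1)`-dimensional surface measure on a set `B` (used for `B = ∂K` and for the skeleton). -/
abbrev surf {m : ℕ} (B : Set (Space m)) : Measure (Space m) :=
  (Measure.euclideanHausdorffMeasure (m - 1)).restrict B

/-- The outer unit normal of a convex body `K` at `x ∈ ∂K`: the unit vector `N` such that `K` lies in
the half space `⟪N, y - x⟫ ≤ 0`, at those `x` where there is exactly one such vector (for a simplex,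
these are the boundary points in the relative interiors of the facets; the others form a set of
surface measure zero, where the value is set to `0`). -/
def outerNormal {m : ℕ} (K : Set (Space m)) (x : Space m) : Space m :=
  open Classical in
  if h : ∃! N : Space m, ‖N‖ = 1 ∧ ∀ y ∈ K, inner ℝ N (y - x) ≤ 0 then h.choose else 0

/-- `g` is the weak partial derivative `∂_μ f` in the interior of `K`. -/
def HasWeakPartial {m : ℕ} (K : Set (Space m)) (μ : Fin m) (f g : Lp ℝ 2 (vol K)) : Prop :=
  ∀ φ : Space m → ℝ, ContDiff ℝ ∞ φ → HasCompactSupport φ → tsupport φ ⊆ interior K →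
    ∫ x in K, f x * fderiv ℝ φ x (EuclideanSpace.single μ 1) = - ∫ x in K, g x * φ x

/-- `f ∈ H¹(K)`. -/
def MemH1 {m : ℕ} (K : Set (Space m)) (f : Lp ℝ 2 (vol K)) : Prop :=
  ∀ μ : Fin m, ∃ g : Lp ℝ 2 (vol K), HasWeakPartial K μ f g

/-- `f ∈ H²(K)`. -/
def MemH2 {m : ℕ} (K : Set (Space m)) (f : Lp ℝ 2 (vol K)) : Prop :=
  ∀ μ : Fin m, ∃ g : Lp ℝ 2 (vol K), HasWeakPartial K μ f g ∧ MemH1 K g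

/-- The weak partial derivative `∂_μ f` (which is unique when it exists). -/
def weakPartial {m : ℕ} (K : Set (Space m)) (μ : Fin m) (f : Lp ℝ 2 (vol K)) : Lp ℝ 2 (vol K) :=
  open Classical in
  if h : ∃ g : Lp ℝ 2 (vol K), HasWeakPartial K μ f g then h.choose else 0

/-- `g ∈ L²(∂K)` is the trace of `f ∈ H¹(K)`: some sequence of functions that are smooth on all of
space converges to `f` in `H¹(K)` while its restrictions to `∂K` converge to `g` in `L²(∂K)`. -/
def IsTrace {m : ℕ} (K : Set (Space m)) (f : Lp ℝ 2 (vol K)) (g : Lp ℝ 2 (surf (frontier K))) :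
    Prop :=
  ∃ φ : ℕ → Space m → ℝ, (∀ k, ContDiff ℝ ∞ (φ k)) ∧
    Tendsto (fun k => eLpNorm (fun x => φ k x - f x) 2 (vol K)) atTop (𝓝 0) ∧
    (∀ μ : Fin m, Tendsto (fun k => eLpNorm (fun x =>
      fderiv ℝ (φ k) x (EuclideanSpace.single μ 1) - weakPartial K μ f x) 2 (vol K)) atTop (𝓝 0)) ∧
    Tendsto (fun k => eLpNorm (fun x => φ k x - g x) 2 (surf (frontier K))) atTop (𝓝 0)

/-- The trace on `∂K` of `f ∈ H¹(K)`. -/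
def trace {m : ℕ} (K : Set (Space m)) (f : Lp ℝ 2 (vol K)) : Lp ℝ 2 (surf (frontier K)) :=
  open Classical in
  if h : ∃ g : Lp ℝ 2 (surf (frontier K)), IsTrace K f g then h.choose else 0

/-- The component with index `i` of a vector-valued square-integrable function. -/
def comp {m : ℕ} {ι : Type} [Fintype ι] {K : Set (Space m)} (i : ι)
    (f : Lp (EuclideanSpace ℝ ι) 2 (vol K)) : Lp ℝ 2 (vol K) :=
  (EuclideanSpace.proj i : EuclideanSpace ℝ ι →L[ℝ] ℝ).compLp f

/-- The componentwise trace of a vector-valued function. -/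
def traceVec {m : ℕ} {ι : Type} [Fintype ι] {K : Set (Space m)}
    (f : Lp (EuclideanSpace ℝ ι) 2 (vol K)) (x : Space m) : EuclideanSpace ℝ ι :=
  WithLp.toLp 2 fun i => trace K (comp i f) x

/-- The boundary integral `∫_{∂K} a^i b_i^μ d^{m-1}x_μ`, where `d^{m-1}x_μ` is `N_μ` times surface
measure, with `N` the outer unit normal. -/
def bdryInt {m n : ℕ} (K : Set (Space m)) (a : Space m → Fld n) (b : Space m → Flx m n) : ℝ :=
  ∫ x, ∑ i, ∑ μ, a x i * b x (μ, i) * outerNormal K x μ ∂surf (frontier K)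

/-- The boundary integral `∫_{∂K} (a^i b'_i^μ - a'^i b_i^μ) d^{m-1}x_μ` of the 2-form `da ∧ db`
evaluated on a pair of variations `(a, b)`, `(a', b')`. -/
def bdryWedge {m n : ℕ} (K : Set (Space m)) (a : Space m → Fld n) (b : Space m → Flx m n)
    (a' : Space m → Fld n) (b' : Space m → Flx m n) : ℝ :=
  ∫ x, ∑ i, ∑ μ, (a x i * b' x (μ, i) - a' x i * b x (μ, i)) * outerNormal K x μ
    ∂surf (frontier K)

/-- The density `v^i r'_i - v'^i r_i`, in `L¹(K)`: the 2-form `du^i ∧ dp_i` evaluated on a pair of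
variations whose `(u, p)` components are `(v, r)` and `(v', r')`. -/
def omegaZero {m n : ℕ} {K : Set (Space m)} (v r v' r' : Lp (Fld n) 2 (vol K)) : Lp ℝ 1 (vol K) :=
  ((L2.integrable_inner (𝕜 := ℝ) v r').sub (L2.integrable_inner (𝕜 := ℝ) v' r)).toL1 _

/-! ### Triangulations and finite element spaces -/

/-- `T` is a simplicial triangulation of the polyhedral domain `Ω ⊆ ℝ^m` by `m`-simplices. -/
structure IsTriangulation {m : ℕ} (T : Geometry.SimplicialComplex ℝ (Space m))
    (Ω : Set (Space m)) : Prop where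
  finite : T.faces.Finite
  pure : ∀ s ∈ T.faces, ∃ K ∈ T.faces, s ⊆ K ∧ K.card = m + 1
  eq_interior : Ω = interior T.space

/-- The `m`-simplices of a triangulation, given by their vertices. -/
abbrev Element {m : ℕ} (T : Geometry.SimplicialComplex ℝ (Space m)) :=
  {K : Finset (Space m) // K ∈ T.faces ∧ K.card = m + 1}

/-- The closed simplex with the given vertices. -/
abbrev Element.body {m : ℕ} {T : Geometry.SimplicialComplex ℝ (Space m)} (K : Element T) :
    Set (Space m) :=
  convexHull ℝ (K.1 : Set (Space m))

/-- The union of the boundaries `∂K` of all elements. -/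
abbrev skeleton {m : ℕ} (T : Geometry.SimplicialComplex ℝ (Space m)) : Set (Space m) :=
  ⋃ K : Element T, frontier K.body

/-- A choice of finite element spaces on a triangulation. The dual space `V(K)^*` is realized, as it
has to be for `H(t, x, u, p, σ)` to make sense, by functions `p` acting through `v ↦ ∫_K p_i v^i`. -/
structure Spaces {m : ℕ} (T : Geometry.SimplicialComplex ℝ (Space m)) (n : ℕ) where
  V : ∀ K : Element T, Submodule ℝ (Lp (Fld n) 2 (vol K.body))
  Vdual : ∀ K : Element T, Submodule ℝ (Lp (Fld n) 2 (vol K.body))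
  S : ∀ K : Element T, Submodule ℝ (Lp (Flx m n) 2 (vol K.body))
  Vhat : Submodule ℝ (Lp (Fld n) 2 (surf (skeleton T)))
  V_finite : ∀ K, FiniteDimensional ℝ (V K)
  S_finite : ∀ K, FiniteDimensional ℝ (S K)
  V_H2 : ∀ K, ∀ v ∈ V K, ∀ i, MemH2 K.body (comp i v)
  S_H1 : ∀ K, ∀ τ ∈ S K, ∀ j, MemH1 K.body (comp j τ)
  Vdual_dual : ∀ K, ∀ ℓ : V K →ₗ[ℝ] ℝ, ∃! r : Vdual K, ∀ v : V K,
    ∫ x in K.body, inner ℝ (r.1 x) (v.1 x) = ℓ v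

/-- A numerical flux function: it determines `σ̂`, on the boundary of each element, from `u`, `σ`
and `û`. -/
abbrev FluxFunction {m n : ℕ} {T : Geometry.SimplicialComplex ℝ (Space m)} (X : Spaces T n) :=
  (∀ K, X.V K) × (∀ K, X.S K) × X.Vhat →
    ∀ K : Element T, Lp (Flx m n) 2 (surf (frontier K.body))

/-- Time-dependent fields `(u(t), p(t), σ(t), û(t)) ∈ V × V^* × Σ × V̂`. -/
structure Fields {m n : ℕ} {T : Geometry.SimplicialComplex ℝ (Space m)} (X : Spaces T n) where
  u : ℝ → ∀ K, X.V K
  p : ℝ → ∀ K, X.Vdual K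
  σ : ℝ → ∀ K, X.S K
  uhat : ℝ → X.Vhat

section

variable {m n : ℕ} {T : Geometry.SimplicialComplex ℝ (Space m)} {X : Spaces T n}

/-- The values of `(u, p, σ)` at the time `t` and the point `x` of the element `K`. -/
def Fields.val (y : Fields X) (K : Element T) (t : ℝ) (x : Space m) : Phase m n :=
  ((y.u t K).1 x, (y.p t K).1 x, (y.σ t K).1 x)

/-- The argument `(u, σ, û)` of the flux function. -/
def Fields.arg (y : Fields X) (t : ℝ) : (∀ K, X.V K) × (∀ K, X.S K) × X.Vhat :=
  (y.u t, y.σ t, y.uhat t)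

/-- The three weak equations on the element `K` at time `t`, for all test functions `r ∈ V(K)^*`,
`τ ∈ Σ(K)` and `v ∈ V(K)`, where `û`, `σ̂` are the approximate traces and `G x` is a covector on phase
space whose components stand in the places of `(∂H/∂u, ∂H/∂p, ∂H/∂σ)`. It is understood that `u` and
`p` are differentiable in time and that the integrals exist. -/
structure WeakEquations (y : Fields X) (G : Space m → Phase m n →L[ℝ] ℝ)
    (σhat : Space m → Flx m n) (K : Element T) (t : ℝ) : Prop where
  diff_u : DifferentiableAt ℝ (fun s => y.u s K) t
  diff_p : DifferentiableAt ℝ (fun s => y.p s K) t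
  int_r : ∀ r : X.Vdual K, Integrable (fun x => G x (0, r.1 x, 0)) (vol K.body)
  int_τ : ∀ τ : X.S K, Integrable (fun x => G x (0, 0, τ.1 x)) (vol K.body)
  int_v : ∀ v : X.V K, Integrable (fun x => G x (v.1 x, 0, 0)) (vol K.body)
  eq_r : ∀ r : X.Vdual K,
    ∫ x in K.body, ∑ i, (deriv (fun s => y.u s K) t).1 x i * r.1 x i =
      ∫ x in K.body, G x (0, r.1 x, 0)
  eq_τ : ∀ τ : X.S K,
    0 = (∫ x in K.body,
          ((∑ i, ∑ μ, (y.u t K).1 x i * weakPartial K.body μ (comp (μ, i) τ.1) x) +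
            G x (0, 0, τ.1 x))) -
        bdryInt K.body (y.uhat t).1 (traceVec τ.1)
  eq_v : ∀ v : X.V K,
    ∫ x in K.body, ∑ i, (deriv (fun s => y.p s K) t).1 x i * v.1 x i =
      (∫ x in K.body,
          ((∑ i, ∑ μ, (y.σ t K).1 x (μ, i) * weakPartial K.body μ (comp i v.1) x) -
            G x (v.1 x, 0, 0))) -
        bdryInt K.body (traceVec v.1) σhat

/-- `y = (u, p, σ, û)` satisfies the semidiscrete de Donder–Weyl equations on `K` at time `t`, for
the Hamiltonian `H` and the flux function `Φ`. -/
def SolvesOn (H : ℝ → Space m → Phase m n → ℝ) (Φ : FluxFunction X) (y : Fields X)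
    (K : Element T) (t : ℝ) : Prop :=
  WeakEquations y (fun x => fderiv ℝ (H t x) (y.val K t x)) (Φ (y.arg t) K) K t

variable [Fintype (Element T)]

/-- The variation `dσ̂` of the numerical flux induced by the variation `z` of `y`. -/
def fluxVariation (Φ : FluxFunction X) (y z : Fields X) (K : Element T) (t : ℝ) :
    Lp (Flx m n) 2 (surf (frontier K.body)) :=
  fderiv ℝ Φ (y.arg t) (z.arg t) K

/-- `z = (v, r, τ, v̂)` satisfies on `K` at time `t` the linearization of the semidiscrete equations
about `y = (u, p, σ, û)`: the first derivatives of `H` are replaced by its Hessian at `(u, p, σ)`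
applied to `(v, r, τ)`, and `σ̂` by its variation. -/
def LinearizedOn (H : ℝ → Space m → Phase m n → ℝ) (Φ : FluxFunction X) (y z : Fields X)
    (K : Element T) (t : ℝ) : Prop :=
  WeakEquations z (fun x => fderiv ℝ (fderiv ℝ (H t x)) (y.val K t x) (z.val K t x))
    (fluxVariation Φ y z K t) K t

/-- `z` is a first variation, on `K`, of the solution `y` on the time interval `(t₀, t₁)`. -/
def IsVariation (H : ℝ → Space m → Phase m n → ℝ) (Φ : FluxFunction X) (t₀ t₁ : ℝ)
    (y z : Fields X) (K : Element T) : Prop :=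
  ∀ t ∈ Ioo t₀ t₁, LinearizedOn H Φ y z K t

/-- The curve `t ↦ du^i ∧ dp_i` in `L¹(K)`, evaluated on the variations `z`, `z'`. -/
def density (z z' : Fields X) (K : Element T) (t : ℝ) : Lp ℝ 1 (vol K.body) :=
  omegaZero (z.u t K).1 (z.p t K).1 (z'.u t K).1 (z'.p t K).1

/-- `∫_K ∂_t (du^i ∧ dp_i) d^m x`, evaluated on the variations `z`, `z'`. -/
def rateOfChange (z z' : Fields X) (K : Element T) (t : ℝ) : ℝ :=
  ∫ x in K.body, (deriv (density z z' K) t) x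

/-- `∫_{∂K} (dû^i ∧ dσ̂_i^μ) d^{m-1}x_μ`, evaluated on the variations `z`, `z'` of `y`. -/
def boundaryFlux (Φ : FluxFunction X) (y z z' : Fields X) (K : Element T) (t : ℝ) : ℝ :=
  bdryWedge K.body (z.uhat t).1 (fluxVariation Φ y z K t)
    (z'.uhat t).1 (fluxVariation Φ y z' K t)

/-- `∫_{∂K} (d(û^i - u^i) ∧ d(σ̂_i^μ - σ_i^μ)) d^{m-1}x_μ`, evaluated on the variations `z`, `z'` of
`y`. -/
def boundaryDefect (Φ : FluxFunction X) (y z z' : Fields X) (K : Element T) (t : ℝ) : ℝ :=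
  bdryWedge K.body
    (fun x => (z.uhat t).1 x - traceVec (z.u t K).1 x)
    (fun x => fluxVariation Φ y z K t x - traceVec (z.σ t K).1 x)
    (fun x => (z'.uhat t).1 x - traceVec (z'.u t K).1 x)
    (fun x => fluxVariation Φ y z' K t x - traceVec (z'.σ t K).1 x)

end

end HybridDDW

end

/-! The density is bilinear in the two variations, so the product rule splits its rate of change
into four integrals. Each pairs a time derivative of one variation with a field of the other, hence
is given by a weak equation of one variation tested with the other. The Hessian terms that enter are
the `(u, p)` parts of D²H(z, z') − D²H(z', z). By symmetry of the Hessian they equal minus the `σ`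
part, which the remaining weak equation evaluates. The interior terms left over are ∫ v ∂τ' + τ' ∂v
minus the same with the variations exchanged, and integration by parts makes them boundary integrals
of v τ'. Altogether the rate is the antisymmetrized integral over ∂K, against the normal, of vτ' −
v̂τ' − vτ̂' = (v̂ − v)(τ̂' − τ') − v̂τ̂', which is the claim. `rateOfChange_eq_bdryWedge` carries
out this algebra.

The analytic content is `integral_traceVec`, integration by parts on a simplex for `H¹` functions,
where normal, surface measure and trace are given only by intrinsic definitions. For `C¹` functions
it comes from the divergence theorem `setIntegral_fderiv_convexHull`: insert a product of smooth
steps in the barycentric coordinates, integrate by parts on all of space, and let the width of the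
steps tend to zero, so that the derivative of each step concentrates on one facet. The formula
passes to `H¹` by approximation: `exists_smooth_approx` provides smooth functions converging in
`H¹`, and `exists_trace_inequality` makes their restrictions to ∂K converge in `L²`. Uniqueness of
weak derivatives and of traces plays no role, since the approximating sequences converge to the very
representatives chosen in `weakPartial` and `trace`. -/

namespace HybridDDW

/-! ### Barycentric coordinates, facets and the outer normal of a simplex -/

section Simplex

set_option linter.unusedSectionVars false

variable {m : ℕ} {ι : Type*} [Fintype ι] (b : AffineBasis ι ℝ (Space m))

/-- The gradient of a barycentric coordinate. -/
noncomputable def coordGrad (i : ι) : Space m :=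
  (InnerProductSpace.toDual ℝ (Space m)).symm (b.coord i).linear.toContinuousLinearMap

theorem inner_coordGrad (i : ι) (w : Space m) :
    inner ℝ (coordGrad b i) w = (b.coord i).linear w := by
  simp [coordGrad]

theorem coord_add (i : ι) (x w : Space m) :
    b.coord i (x + w) = b.coord i x + inner ℝ (coordGrad b i) w := by
  rw [inner_coordGrad, add_comm x w, ← vadd_eq_add, AffineMap.map_vadd, vadd_eq_add, add_comm]

theorem contDiff_coord (i : ι) : ContDiff ℝ ∞ (b.coord i) := by
  have : (b.coord i : Space m → ℝ) = fun x => b.coord i 0 + innerSL ℝ (coordGrad b i) x := by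
    ext x; rw [innerSL_apply_apply, ← coord_add, zero_add]
  rw [this]; fun_prop

theorem hasFDerivAt_coord (i : ι) (x : Space m) :
    HasFDerivAt (b.coord i) (innerSL ℝ (coordGrad b i)) x := by
  have : (b.coord i : Space m → ℝ) = fun x => b.coord i 0 + innerSL ℝ (coordGrad b i) x := by
    ext x; rw [innerSL_apply_apply, ← coord_add, zero_add]
  rw [this]; exact (innerSL ℝ (coordGrad b i)).hasFDerivAt.const_add _

theorem continuous_coord (i : ι) : Continuous (b.coord i) := (contDiff_coord b i).continuous

/-- The facet of a simplex opposite to a vertex. -/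
def facet (i : ι) : Set (Space m) := {x | (∀ j, 0 ≤ b.coord j x) ∧ b.coord i x = 0}

theorem convexHull_eq_coord : convexHull ℝ (range b) = {x | ∀ j, 0 ≤ b.coord j x} :=
  b.convexHull_eq_nonneg_coord

theorem isCompact_convexHull_range : IsCompact (convexHull ℝ (range b)) :=
  (finite_range b).isCompact_convexHull (𝕜 := ℝ)

theorem frontier_convexHull_range : frontier (convexHull ℝ (range b)) = ⋃ i, facet b i := by
  rw [frontier, (isCompact_convexHull_range b).isClosed.closure_eq, b.interior_convexHull,
    convexHull_eq_coord]
  ext x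
  simp only [Set.mem_sdiff, mem_ofPred_eq, not_forall, not_lt, mem_iUnion, facet]
  constructor
  · rintro ⟨h, i, hi⟩
    exact ⟨i, h, le_antisymm hi (h i)⟩
  · rintro ⟨i, h, hi⟩
    exact ⟨h, i, hi.le⟩

theorem isClosed_facet (i : ι) : IsClosed (facet b i) := by
  have : facet b i = (⋂ j, b.coord j ⁻¹' Ici 0) ∩ b.coord i ⁻¹' {0} := by
    ext; simp [facet]
  rw [this]
  exact (isClosed_iInter fun j => isClosed_Ici.preimage (continuous_coord b j)).inter
    (isClosed_singleton.preimage (continuous_coord b i))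

theorem facet_subset (i : ι) : facet b i ⊆ convexHull ℝ (range b) := by
  rw [convexHull_eq_coord]; exact fun x hx => hx.1

theorem exists_ne_of_pos (b : AffineBasis ι ℝ (Space m)) (hm : 0 < m) (i : ι) : ∃ j, j ≠ i := by
  have h := b.ind.affineSpan_eq_top_iff_card_eq_finrank_add_one.1 b.tot
  rw [finrank_euclideanSpace, Fintype.card_fin] at h
  have : Nontrivial ι := Fintype.one_lt_card_iff_nontrivial.1 (by omega)
  exact exists_ne i

/-- A coordinate takes the values 1 and 0 at two different vertices. In dimension 0 there is a
single vertex and the coordinate is constant, which is why `0 < m` is needed. -/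
theorem coordGrad_ne_zero (hm : 0 < m) (i : ι) : coordGrad b i ≠ 0 := by
  obtain ⟨j, hj⟩ := exists_ne_of_pos b hm i
  intro h
  have := coord_add b i (b j) (b i - b j)
  rw [h, inner_zero_left, add_sub_cancel, b.coord_apply_eq, b.coord_apply_ne (Ne.symm hj)] at this
  simp at this

/-- The inner unit normal of a facet. -/
noncomputable def facetNormal (i : ι) : Space m := ‖coordGrad b i‖⁻¹ • coordGrad b i

theorem norm_facetNormal (hm : 0 < m) (i : ι) : ‖facetNormal b i‖ = 1 :=
  norm_smul_inv_norm (𝕜 := ℝ) (coordGrad_ne_zero b hm i)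

theorem coordGrad_eq (hm : 0 < m) (i : ι) :
    coordGrad b i = ‖coordGrad b i‖ • facetNormal b i := by
  rw [facetNormal, smul_smul, mul_inv_cancel₀ (norm_ne_zero_iff.2 (coordGrad_ne_zero b hm i)),
    one_smul]

theorem outerNormal_eq_of_unique {K : Set (Space m)} {x N : Space m}
    (hN : ‖N‖ = 1 ∧ ∀ y ∈ K, inner ℝ N (y - x) ≤ 0)
    (huniq : ∀ N', (‖N'‖ = 1 ∧ ∀ y ∈ K, inner ℝ N' (y - x) ≤ 0) → N' = N) :
    outerNormal K x = N := by
  have h : ∃! N : Space m, ‖N‖ = 1 ∧ ∀ y ∈ K, inner ℝ N (y - x) ≤ 0 := ⟨N, hN, huniq⟩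
  rw [outerNormal, dif_pos h]
  exact huniq _ h.choose_spec.1

/-- The outer normal is constant on the relative interior of a facet. -/
theorem outerNormal_facet (hm : 0 < m) {i : ι} {x : Space m} (hi : b.coord i x = 0)
    (hx : ∀ j, j ≠ i → 0 < b.coord j x) :
    outerNormal (convexHull ℝ (range b)) x = -facetNormal b i := by
  have hg : 0 < ‖coordGrad b i‖ := norm_pos_iff.2 (coordGrad_ne_zero b hm i)
  apply outerNormal_eq_of_unique
  · refine ⟨by rw [norm_neg, norm_facetNormal b hm], fun y hy => ?_⟩
    rw [convexHull_eq_coord] at hy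
    have h1 := coord_add b i x (y - x)
    rw [add_sub_cancel, hi, zero_add] at h1
    rw [inner_neg_left, facetNormal, real_inner_smul_left, ← h1]
    have := mul_nonneg (inv_nonneg.2 hg.le) (hy i)
    linarith
  · rintro N ⟨hN, hN'⟩
    -- Only the constraint of index `i` is active at `x`, so `x + t • w` stays in the simplex for
    -- small `t > 0` whenever `w` does not point out of that half space. An admissible `N` is
    -- therefore nonpositive on the whole half space.
    have key : ∀ w, 0 ≤ inner ℝ (coordGrad b i) w → inner ℝ N w ≤ 0 := by
      intro w hw
      have ev : ∀ᶠ t : ℝ in 𝓝[>] 0, ∀ j, 0 ≤ b.coord j (x + t • w) := by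
        rw [eventually_all]
        intro j
        by_cases hj : j = i
        · subst hj
          filter_upwards [self_mem_nhdsWithin] with t ht
          rw [coord_add, hi, zero_add, real_inner_smul_right]
          exact mul_nonneg (le_of_lt ht) hw
        · have hc : Continuous fun t : ℝ => b.coord j (x + t • w) :=
            (continuous_coord b j).comp (by fun_prop)
          have h0 : (fun t : ℝ => b.coord j (x + t • w)) 0 > 0 := by simpa using hx j hj
          have := hc.continuousAt.eventually (lt_mem_nhds h0)
          filter_upwards [nhdsWithin_le_nhds this] with t ht using le_of_lt ht
      obtain ⟨t, ht, ht0⟩ := (ev.and self_mem_nhdsWithin).exists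
      have h1 := hN' (x + t • w) (by rw [convexHull_eq_coord]; exact ht)
      rw [add_sub_cancel_left, real_inner_smul_right] at h1
      exact nonpos_of_mul_nonpos_right h1 ht0
    set ν := facetNormal b i with hν
    have hν1 : ‖ν‖ = 1 := norm_facetNormal b hm i
    -- Testing with `ν` gives ⟪N, ν⟫ ≤ 0, and testing with the tangential part of `N` gives 1 ≤ ⟪N,
    -- ν⟫². Hence ⟪N, ν⟫ = −1, the equality case of Cauchy–Schwarz.
    have h1 : inner ℝ N ν ≤ 0 := by
      refine key ν ?_
      rw [coordGrad_eq b hm i, real_inner_smul_left, real_inner_self_eq_norm_sq]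
      positivity
    have h2 : inner ℝ N (N - inner ℝ N ν • ν) ≤ 0 := by
      refine key _ (le_of_eq ?_)
      rw [coordGrad_eq b hm i, real_inner_smul_left, inner_sub_right, real_inner_smul_right,
        ← hν, real_inner_self_eq_norm_sq, hν1, real_inner_comm]
      ring
    rw [inner_sub_right, real_inner_smul_right, real_inner_self_eq_norm_sq, hN] at h2
    have h3 : inner ℝ N (-ν) = 1 := by
      have h4 : |inner ℝ N ν| ≤ 1 := by simpa [hN, hν1] using abs_real_inner_le_norm N ν
      rw [inner_neg_right]
      nlinarith [abs_le.1 h4]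
    exact (inner_eq_one_iff_of_norm_eq_one (𝕜 := ℝ) hN (by rw [norm_neg, hν1])).1 h3

end Simplex

/-! ### Coordinates adapted to a hyperplane, and Hausdorff measure on it -/

section Coordinates

variable {m : ℕ}

/-- The parametrization of space by the distance to the hyperplane through `p` with unit normal `ν`
and the position in that hyperplane. -/
def slabMap (p ν : Space m) (z : ℝ × (Submodule.span ℝ {ν})ᗮ) : Space m := z.1 • ν + z.2 + p

theorem measurePreserving_slabMap (p : Space m) {ν : Space m} (hν : ‖ν‖ = 1) :
    MeasurePreserving (slabMap p ν) (volume.prod volume) volume := by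
  have h1 := ((Submodule.span ℝ {ν}).measurePreserving_measurableEquivProd p).symm
  rw [InnerProductSpace.euclideanHausdorffMeasure_eq_volume] at h1
  have h2 : MeasurePreserving (LinearIsometryEquiv.toSpanUnitSingleton (𝕜 := ℝ) ν hν)
      volume volume := LinearIsometryEquiv.measurePreserving _
  have h3 := h1.comp (h2.prod (MeasurePreserving.id (volume : Measure (Submodule.span ℝ {ν})ᗮ)))
  have hfun : slabMap p ν = ((Submodule.span ℝ {ν}).measurableEquivProd p).symm ∘
      Prod.map (LinearIsometryEquiv.toSpanUnitSingleton (𝕜 := ℝ) ν hν) id := by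
    funext z
    simp [slabMap]
  rw [hfun]
  exact h3

theorem measurableEmbedding_slabMap (p : Space m) {ν : Space m} (hν : ‖ν‖ = 1) :
    MeasurableEmbedding (slabMap p ν) := by
  have h1 := ((Submodule.span ℝ {ν}).measurableEquivProd p).symm.measurableEmbedding
  let h2 := (LinearIsometryEquiv.toSpanUnitSingleton (𝕜 := ℝ) ν
    hν).toHomeomorph.toMeasurableEquiv.prodCongr
      (MeasurableEquiv.refl (Submodule.span ℝ {ν})ᗮ)
  have h3 := h1.comp h2.measurableEmbedding
  convert h3 using 1
  funext z
  simp only [slabMap, Function.comp_apply, Submodule.measurableEquivProd_symm_apply]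
  rfl

theorem integral_slabMap (p : Space m) {ν : Space m} (hν : ‖ν‖ = 1) (G : Space m → ℝ) :
    ∫ x, G x = ∫ z, G (slabMap p ν z) ∂(volume.prod volume) :=
  ((measurePreserving_slabMap p hν).integral_comp (measurableEmbedding_slabMap p hν) G).symm

theorem finrank_orthogonal_singleton {ν : Space m} (hν : ‖ν‖ = 1) :
    Module.finrank ℝ (Submodule.span ℝ {ν})ᗮ = m - 1 := by
  have h := (Submodule.span ℝ {ν}).finrank_add_finrank_orthogonal
  rw [finrank_span_singleton (by intro h; simp [h] at hν), finrank_euclideanSpace,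
    Fintype.card_fin] at h
  omega

/-- The parametrization of a hyperplane by its direction. -/
def planeMap (p ν : Space m) (w : (Submodule.span ℝ {ν})ᗮ) : Space m := w + p

theorem isometry_planeMap (p ν : Space m) : Isometry (planeMap p ν) :=
  Isometry.of_dist_eq fun x y => by simp [planeMap, Subtype.dist_eq]

/-- Isometries transport Hausdorff measure, and on the direction space, of dimension `m - 1`, the
normalized Hausdorff measure is Lebesgue measure. Surface integrals over facets thus become Lebesgue
integrals. -/
theorem map_planeMap (p : Space m) {ν : Space m} (hν : ‖ν‖ = 1) :
    Measure.map (planeMap p ν) volume =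
      (Measure.euclideanHausdorffMeasure (m - 1)).restrict (range (planeMap p ν)) := by
  rw [← (isometry_planeMap p ν).map_euclideanHausdorffMeasure, ← finrank_orthogonal_singleton hν,
    InnerProductSpace.euclideanHausdorffMeasure_eq_volume]

theorem mem_range_planeMap {p ν x : Space m} (h : inner ℝ ν (x - p) = 0) :
    x ∈ range (planeMap p ν) :=
  ⟨⟨x - p, Submodule.mem_orthogonal_singleton_iff_inner_right.2 h⟩, by simp [planeMap]⟩

theorem restrict_eq_map_planeMap {p ν : Space m} (hν : ‖ν‖ = 1) {A : Set (Space m)}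
    (hA : MeasurableSet A) (h : ∀ x ∈ A, inner ℝ ν (x - p) = 0) :
    (Measure.euclideanHausdorffMeasure (m - 1)).restrict A =
      Measure.map (planeMap p ν) (volume.restrict (planeMap p ν ⁻¹' A)) := by
  have hsub : A ⊆ range (planeMap p ν) := fun x hx => mem_range_planeMap (h x hx)
  rw [← Measure.restrict_map (isometry_planeMap p ν).continuous.measurable hA, map_planeMap p hν,
    Measure.restrict_restrict hA, inter_eq_left.2 hsub]

end Coordinates

/-! ### Surface measure on the boundary of a simplex -/

section Simplex

set_option linter.unusedSectionVars false

variable {m : ℕ} {ι : Type*} [Fintype ι] (b : AffineBasis ι ℝ (Space m))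

theorem inner_facetNormal_sub (i : ι) {x p : Space m} (hx : b.coord i x = 0)
    (hp : b.coord i p = 0) : inner ℝ (facetNormal b i) (x - p) = 0 := by
  have := coord_add b i p (x - p)
  rw [add_sub_cancel, hx, hp, zero_add] at this
  rw [facetNormal, real_inner_smul_left, ← this, mul_zero]

theorem coord_planeMap (i : ι) {p : Space m} (hp : b.coord i p = 0)
    (w : (Submodule.span ℝ {facetNormal b i})ᗮ) :
    b.coord i (planeMap p (facetNormal b i) w) = 0 := by
  have hw : inner ℝ (facetNormal b i) (w : Space m) = 0 :=
    Submodule.mem_orthogonal_singleton_iff_inner_right.1 w.2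
  by_cases hg : coordGrad b i = 0
  · rw [planeMap, add_comm, coord_add, hp, hg, inner_zero_left, add_zero]
  · have hw : ‖coordGrad b i‖⁻¹ * inner ℝ (coordGrad b i) (w : Space m) = 0 := by
      rw [← real_inner_smul_left]; exact hw
    rw [planeMap, add_comm, coord_add, hp, zero_add]
    exact (mul_eq_zero.1 hw).resolve_left (inv_ne_zero (norm_ne_zero_iff.2 hg))

/-- On the hyperplane of the facet `i`, the coordinate `j` is an affine function equal to 1 at the
vertex `b j`. Its zero set is a proper affine subspace, hence null. -/
theorem volume_coord_planeMap (i j : ι) (hij : j ≠ i) {p : Space m} (hp : b.coord i p = 0) :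
    volume {w | b.coord j (planeMap p (facetNormal b i) w) = 0} = 0 := by
  set ν := facetNormal b i
  let f : (Submodule.span ℝ {ν})ᗮ →ᵃ[ℝ] ℝ := (b.coord j).comp
    ((Submodule.span ℝ {ν})ᗮ.subtype.toAffineMap + AffineMap.const ℝ _ p)
  have hf : ∀ w, f w = b.coord j (planeMap p ν w) := fun w => by simp [f, planeMap]
  have hset : {w | b.coord j (planeMap p ν w) = 0} =
      ((AffineSubspace.mk' (0 : ℝ) ⊥).comap f : Set _) := by
    ext w
    simp [hf, AffineSubspace.mem_mk']
  rw [hset]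
  apply Measure.addHaar_affineSubspace
  intro htop
  obtain ⟨w, hw⟩ : b j ∈ range (planeMap p ν) :=
    mem_range_planeMap (inner_facetNormal_sub b i (b.coord_apply_ne hij.symm) hp)
  have : w ∈ (AffineSubspace.mk' (0 : ℝ) ⊥).comap f := htop ▸ AffineSubspace.mem_top _ _ _
  rw [AffineSubspace.mem_comap, AffineSubspace.mem_mk', hf, hw, b.coord_apply_eq] at this
  simp at this

theorem exists_coord_eq_zero (b : AffineBasis ι ℝ (Space m)) (hm : 0 < m) (i : ι) :
    ∃ p, b.coord i p = 0 := by
  obtain ⟨j, hj⟩ := exists_ne_of_pos b hm i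
  exact ⟨b j, b.coord_apply_ne hj.symm⟩

theorem surf_facet (hm : 0 < m) (i : ι) {p : Space m} (hp : b.coord i p = 0) :
    surf (facet b i) = Measure.map (planeMap p (facetNormal b i))
      (volume.restrict (planeMap p (facetNormal b i) ⁻¹' facet b i)) :=
  restrict_eq_map_planeMap (norm_facetNormal b hm i) (isClosed_facet b i).measurableSet
    fun _ hx => inner_facetNormal_sub b i hx.2 hp

theorem surf_facet_coord_eq_zero (hm : 0 < m) (i j : ι) (hij : j ≠ i) :
    ∀ᵐ x ∂surf (facet b i), b.coord j x ≠ 0 := by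
  obtain ⟨p, hp⟩ := exists_coord_eq_zero b hm i
  rw [surf_facet b hm i hp, ae_map_iff (isometry_planeMap _ _).continuous.aemeasurable]
  · apply ae_restrict_of_ae
    rw [ae_iff]
    simpa using volume_coord_planeMap b i j hij hp
  · exact ((continuous_coord b j).measurable (measurableSet_singleton 0)).compl

/-- Two distinct facets meet where a second coordinate vanishes, which is a null set, so surface
measure is additive over the facets. -/
theorem surf_frontier (hm : 0 < m) :
    surf (frontier (convexHull ℝ (range b))) = Measure.sum fun i => surf (facet b i) := by
  rw [surf, frontier_convexHull_range]
  apply Measure.restrict_iUnion_ae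
  · intro i j hij
    have h := surf_facet_coord_eq_zero b hm i j hij.symm
    rw [surf, ae_restrict_iff' (isClosed_facet b i).measurableSet, ae_iff] at h
    refine measure_mono_null ?_ h
    rintro x ⟨hi, hj⟩
    simp [hi, hj.2]
  · exact fun i => (isClosed_facet b i).measurableSet.nullMeasurableSet

theorem isFiniteMeasure_surf_facet (hm : 0 < m) (i : ι) : IsFiniteMeasure (surf (facet b i)) := by
  obtain ⟨p, hp⟩ := exists_coord_eq_zero b hm i
  rw [surf_facet b hm i hp]
  have hc : IsCompact (planeMap p (facetNormal b i) ⁻¹' facet b i) := by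
    have hclosed : IsClosed (range (planeMap p (facetNormal b i))) :=
      (isometry_planeMap p _).isClosedEmbedding.isClosed_range
    exact (isometry_planeMap p _).isClosedEmbedding.isCompact_preimage
      ((isCompact_convexHull_range b).of_isClosed_subset (isClosed_facet b i) (facet_subset b i))
  have : IsFiniteMeasure (volume.restrict (planeMap p (facetNormal b i) ⁻¹' facet b i)) :=
    ⟨by rw [Measure.restrict_apply_univ]; exact hc.measure_lt_top⟩
  infer_instance

theorem isFiniteMeasure_surf_frontier (hm : 0 < m) :
    IsFiniteMeasure (surf (frontier (convexHull ℝ (range b)))) := by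
  rw [surf_frontier b hm]
  have := fun i => isFiniteMeasure_surf_facet b hm i
  infer_instance

theorem outerNormal_ae_facet (hm : 0 < m) (i : ι) :
    ∀ᵐ x ∂surf (facet b i), outerNormal (convexHull ℝ (range b)) x = -facetNormal b i := by
  have h : ∀ᵐ x ∂surf (facet b i), ∀ j, j ≠ i → b.coord j x ≠ 0 := by
    rw [ae_all_iff]
    intro j
    by_cases hj : j = i
    · simp [hj]
    · filter_upwards [surf_facet_coord_eq_zero b hm i j hj] with x hx using fun _ => hx
  filter_upwards [h, ae_restrict_mem (isClosed_facet b i).measurableSet] with x hx hxf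
  exact outerNormal_facet b hm hxf.2 fun j hj => (hxf.1 j).lt_of_ne' (hx j hj)

theorem aestronglyMeasurable_outerNormal (hm : 0 < m) :
    AEStronglyMeasurable (outerNormal (convexHull ℝ (range b)))
      (surf (frontier (convexHull ℝ (range b)))) := by
  rw [surf_frontier b hm, aestronglyMeasurable_sum_measure_iff]
  exact fun i => aestronglyMeasurable_const.congr
    (EventuallyEq.symm (outerNormal_ae_facet b hm i))

theorem norm_outerNormal_le (K : Set (Space m)) (x : Space m) : ‖outerNormal K x‖ ≤ 1 := by
  rw [outerNormal]
  split_ifs with h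
  · exact h.choose_spec.1.1.le
  · simp

theorem integral_mul_outerNormal (hm : 0 < m) {F : Space m → ℝ}
    (hF : Integrable F (surf (frontier (convexHull ℝ (range b))))) (a : Space m) :
    ∫ x, F x * inner ℝ (outerNormal (convexHull ℝ (range b)) x) a
        ∂surf (frontier (convexHull ℝ (range b))) =
      -∑ i, inner ℝ (facetNormal b i) a * ∫ x, F x ∂surf (facet b i) := by
  have hint : Integrable (fun x => F x * inner ℝ (outerNormal (convexHull ℝ (range b)) x) a)
      (surf (frontier (convexHull ℝ (range b)))) := by
    refine hF.mul_bdd (c := ‖a‖)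
      ((aestronglyMeasurable_outerNormal b hm).inner aestronglyMeasurable_const) ?_
    refine Eventually.of_forall fun x => (norm_inner_le_norm _ _).trans ?_
    exact mul_le_of_le_one_left (norm_nonneg _) (norm_outerNormal_le _ _)
  rw [surf_frontier b hm] at hint ⊢
  rw [integral_sum_measure hint, tsum_fintype, ← Finset.sum_neg_distrib]
  refine Finset.sum_congr rfl fun i _ => ?_
  rw [← integral_const_mul, ← integral_neg]
  refine integral_congr_ae ?_
  filter_upwards [outerNormal_ae_facet b hm i] with x hx
  rw [hx, inner_neg_left]
  ring

end Simplex

/-! ### The smooth step function -/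

section Transition

/-- At such points the step attains its global minimum 0 or maximum 1. The extremum argument covers
the end points 0 and 1 as well. -/
theorem deriv_smoothTransition_eq_zero {s : ℝ} (hs : s ≤ 0 ∨ 1 ≤ s) :
    deriv Real.smoothTransition s = 0 := by
  rcases hs with hs | hs
  · refine IsLocalMin.deriv_eq_zero (Eventually.of_forall fun t => ?_)
    rw [Real.smoothTransition.zero_of_nonpos hs]
    exact Real.smoothTransition.nonneg t
  · refine IsLocalMax.deriv_eq_zero (Eventually.of_forall fun t => ?_)
    rw [Real.smoothTransition.one_of_one_le hs]
    exact Real.smoothTransition.le_one t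

theorem hasDerivAt_smoothTransition (s : ℝ) :
    HasDerivAt Real.smoothTransition (deriv Real.smoothTransition s) s :=
  ((Real.smoothTransition.contDiff (n := 1)).differentiable (by simp) s).hasDerivAt

theorem continuous_deriv_smoothTransition : Continuous (deriv Real.smoothTransition) :=
  (Real.smoothTransition.contDiff (n := 1)).continuous_deriv (by simp)

theorem integrable_deriv_smoothTransition : Integrable (deriv Real.smoothTransition) := by
  refine continuous_deriv_smoothTransition.integrable_of_hasCompactSupport
    (HasCompactSupport.of_support_subset_isCompact (isCompact_Icc (a := 0) (b := 1)) ?_)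
  intro s hs
  by_contra h
  refine hs (deriv_smoothTransition_eq_zero ?_)
  rw [mem_Icc, not_and_or, not_le, not_le] at h
  exact h.imp le_of_lt le_of_lt

theorem integral_deriv_smoothTransition : ∫ s, deriv Real.smoothTransition s = 1 := by
  have h := integral_of_hasDerivAt_of_tendsto (m := 0) (n := 1) hasDerivAt_smoothTransition
    integrable_deriv_smoothTransition ?_ ?_
  · rw [h, sub_zero]
  · refine tendsto_const_nhds.congr' ?_
    filter_upwards [eventually_le_atBot 0] with s hs
    exact (Real.smoothTransition.zero_of_nonpos hs).symm
  · refine tendsto_const_nhds.congr' ?_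
    filter_upwards [eventually_ge_atTop 1] with s hs
    exact (Real.smoothTransition.one_of_one_le hs).symm

/-- A smooth step of vanishing width tends to a jump. -/
theorem tendsto_smoothTransition_div {q : ℝ → ℝ} {c : ℝ} (hq : Tendsto q (𝓝[>] 0) (𝓝 c))
    (hc : c ≠ 0) : Tendsto (fun ε => Real.smoothTransition (q ε / ε)) (𝓝[>] 0)
      (𝓝 (if 0 < c then 1 else 0)) := by
  refine tendsto_const_nhds.congr' ?_
  rcases lt_or_gt_of_ne hc with h | h
  · rw [if_neg h.not_gt]
    filter_upwards [hq.eventually (gt_mem_nhds h), self_mem_nhdsWithin] with ε h1 h2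
    exact (Real.smoothTransition.zero_of_nonpos (div_nonpos_of_nonpos_of_nonneg h1.le
      (le_of_lt h2))).symm
  · rw [if_pos h]
    have h3 : ∀ᶠ ε : ℝ in 𝓝[>] 0, ε < c / 2 :=
      nhdsWithin_le_nhds (gt_mem_nhds (half_pos h))
    filter_upwards [hq.eventually (lt_mem_nhds (half_lt_self h)), self_mem_nhdsWithin, h3]
      with ε h1 h2 h3
    exact (Real.smoothTransition.one_of_one_le ((one_le_div h2).2 (h3.le.trans h1.le))).symm

end Transition

/-! ### The divergence theorem on a simplex -/

section Simplex

set_option linter.unusedSectionVars false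

variable {m : ℕ} {ι : Type*} [Fintype ι] (b : AffineBasis ι ℝ (Space m))

/-- Stretching the normal variable by `c` costs the factor `c`. With `c` proportional to `ε` this
blows the boundary layer of width `ε` up to unit width. -/
theorem integral_slabMap_mul (p : Space m) {ν : Space m} (hν : ‖ν‖ = 1) {c : ℝ} (hc : 0 < c)
    (G : Space m → ℝ) :
    ∫ x, G x = c * ∫ z, G (slabMap p ν (c * z.1, z.2)) ∂(volume.prod volume) := by
  have hmap : (volume : Measure ℝ).prod (volume : Measure (Submodule.span ℝ {ν})ᗮ) =
      ENNReal.ofReal c • Measure.map (Prod.map (c * ·) id) (volume.prod volume) := by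
    rw [← Measure.map_prod_map _ _ (by fun_prop) measurable_id, Measure.map_id,
      ← Measure.prod_smul_left]
    congr 1
    have h := Real.smul_map_volume_mul_left hc.ne'
    rw [abs_of_pos hc] at h
    exact h.symm
  have hemb : MeasurableEmbedding
      (Prod.map (c * ·) id : ℝ × (Submodule.span ℝ {ν})ᗮ → ℝ × (Submodule.span ℝ {ν})ᗮ) :=
    ((Homeomorph.mulLeft₀ c hc.ne').toMeasurableEquiv.prodCongr
      (MeasurableEquiv.refl _)).measurableEmbedding
  rw [integral_slabMap p hν]
  conv_lhs => rw [hmap, integral_smul_measure, hemb.integral_map, ENNReal.toReal_ofReal hc.le]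
  rfl

/-- A product of smooth steps of width `ε` in barycentric coordinates. -/
noncomputable def cutoff (s : Finset ι) (ε : ℝ) (x : Space m) : ℝ :=
  ∏ i ∈ s, Real.smoothTransition (b.coord i x / ε)

theorem cutoff_nonneg (s : Finset ι) (ε : ℝ) (x : Space m) : 0 ≤ cutoff b s ε x :=
  Finset.prod_nonneg fun _ _ => Real.smoothTransition.nonneg _

theorem cutoff_le_one (s : Finset ι) (ε : ℝ) (x : Space m) : cutoff b s ε x ≤ 1 :=
  Finset.prod_le_one (fun _ _ => Real.smoothTransition.nonneg _)
    fun _ _ => Real.smoothTransition.le_one _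

theorem coord_pos_of_cutoff_ne_zero {s : Finset ι} {ε : ℝ} (hε : 0 < ε) {x : Space m}
    (h : cutoff b s ε x ≠ 0) {i : ι} (hi : i ∈ s) : 0 < b.coord i x := by
  by_contra hneg
  refine h (Finset.prod_eq_zero hi (Real.smoothTransition.zero_of_nonpos ?_))
  exact div_nonpos_of_nonpos_of_nonneg (not_lt.1 hneg) hε.le

theorem continuous_cutoff (s : Finset ι) (ε : ℝ) : Continuous (cutoff b s ε) :=
  continuous_finsetProd _ fun i _ =>
    Real.smoothTransition.continuous.comp ((continuous_coord b i).div_const ε)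

theorem hasFDerivAt_cutoff [DecidableEq ι] (ε : ℝ) (x : Space m) :
    HasFDerivAt (cutoff b Finset.univ ε) (∑ i, cutoff b (Finset.univ.erase i) ε x •
      (deriv Real.smoothTransition (b.coord i x / ε) •
        (ε⁻¹ • innerSL ℝ (coordGrad b i)))) x := by
  refine HasFDerivAt.finsetProd (g := fun i y => Real.smoothTransition (b.coord i y / ε))
    fun i _ => ?_
  refine HasDerivAt.comp_hasFDerivAt x (hasDerivAt_smoothTransition _) ?_
  simp_rw [div_eq_inv_mul]
  exact (hasFDerivAt_coord b i x).const_mul _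

theorem tendsto_cutoff {s : Finset ι} {q : ℝ → Space m} {x : Space m}
    (hq : Tendsto q (𝓝[>] 0) (𝓝 x)) (hx : ∀ i ∈ s, b.coord i x ≠ 0) :
    Tendsto (fun ε => cutoff b s ε (q ε)) (𝓝[>] 0)
      (𝓝 (∏ i ∈ s, if 0 < b.coord i x then 1 else 0)) :=
  tendsto_finsetProd _ fun i hi =>
    tendsto_smoothTransition_div (((continuous_coord b i).tendsto x).comp hq) (hx i hi)

theorem coord_slabMap (hm : 0 < m) (i : ι) {p : Space m} (hp : b.coord i p = 0)
    (z : ℝ × (Submodule.span ℝ {facetNormal b i})ᗮ) :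
    b.coord i (slabMap p (facetNormal b i) z) = z.1 * ‖coordGrad b i‖ := by
  have h1 := coord_planeMap b i hp z.2
  rw [slabMap, add_assoc, add_comm, coord_add]
  rw [planeMap] at h1
  have h2 : inner ℝ (coordGrad b i) (facetNormal b i) = ‖coordGrad b i‖ := by
    conv_lhs => rw [coordGrad_eq b hm i]
    rw [real_inner_smul_left, real_inner_self_eq_norm_sq, norm_facetNormal b hm]
    ring
  rw [h1, real_inner_smul_right, h2, zero_add]

/-- The tangential variable is an orthogonal projection of the displacement from `p`, so it stays
bounded while the point stays in the simplex. This serves the domination in `tendsto_layer`. -/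
theorem norm_le_slabMap {p ν : Space m} (z : ℝ × (Submodule.span ℝ {ν})ᗮ) :
    ‖z.2‖ ≤ ‖slabMap p ν z - p‖ := by
  have hw : inner ℝ ν (z.2 : Space m) = 0 :=
    Submodule.mem_orthogonal_singleton_iff_inner_right.1 z.2.2
  have h1 : inner ℝ (z.2 : Space m) (slabMap p ν z - p) = ‖z.2‖ * ‖z.2‖ := by
    rw [slabMap, add_sub_cancel_right, inner_add_right, real_inner_smul_right,
      real_inner_comm, hw, real_inner_self_eq_norm_mul_norm]
    simp
  have h2 := real_inner_le_norm (z.2 : Space m) (slabMap p ν z - p)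
  rw [h1] at h2
  by_contra! h
  have h0 : 0 < ‖z.2‖ := (norm_nonneg _).trans_lt h
  have : ‖(z.2 : Space m)‖ = ‖z.2‖ := rfl
  rw [this] at h2
  exact absurd (le_of_mul_le_mul_left h2 h0) (not_le.2 h)

theorem continuous_slabMap (p ν : Space m) : Continuous (slabMap p ν) := by
  unfold slabMap; fun_prop

/-- After rescaling the distance to the facet, the derivative of the step becomes a fixed density of
integral 1 in the normal variable, while the other factors tend to the indicator of the facet in its
hyperplane. The prefactor is the inverse of the Jacobian of the rescaling. -/
theorem tendsto_layer [DecidableEq ι] (hm : 0 < m) (i : ι) {F : Space m → ℝ} (hF : Continuous F) :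
    Tendsto (fun ε => ‖coordGrad b i‖ * ε⁻¹ * ∫ x, deriv Real.smoothTransition (b.coord i x / ε) *
      (cutoff b (Finset.univ.erase i) ε x * F x)) (𝓝[>] 0) (𝓝 (∫ x, F x ∂surf (facet b i))) := by
  obtain ⟨p, hp⟩ := exists_coord_eq_zero b hm i
  have hg : 0 < ‖coordGrad b i‖ := norm_pos_iff.2 (coordGrad_ne_zero b hm i)
  set ν := facetNormal b i with hνdef
  have hν : ‖ν‖ = 1 := norm_facetNormal b hm i
  set h' := deriv Real.smoothTransition with hh'
  -- The scale is chosen so that the coordinate `i` of `X ε z`, divided by `ε`, is exactly `z.1`.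
  let X : ℝ → ℝ × (Submodule.span ℝ {ν})ᗮ → Space m := fun ε z =>
    slabMap p ν (ε / ‖coordGrad b i‖ * z.1, z.2)
  have hXc : ∀ ε, Continuous (X ε) := fun ε => (continuous_slabMap p ν).comp (by fun_prop)
  have hcoord : ∀ ε > 0, ∀ z, b.coord i (X ε z) / ε = z.1 := by
    intro ε hε z
    rw [coord_slabMap b hm i hp]
    field_simp
  have heq : ∀ ε > 0, ‖coordGrad b i‖ * ε⁻¹ * ∫ x, h' (b.coord i x / ε) *
      (cutoff b (Finset.univ.erase i) ε x * F x) =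
      ∫ z, h' z.1 * (cutoff b (Finset.univ.erase i) ε (X ε z) * F (X ε z))
        ∂(volume.prod volume) := by
    intro ε hε
    rw [integral_slabMap_mul p hν (div_pos hε hg), ← mul_assoc]
    have : ‖coordGrad b i‖ * ε⁻¹ * (ε / ‖coordGrad b i‖) = 1 := by field_simp
    rw [this, one_mul]
    refine integral_congr_ae (Eventually.of_forall fun z => ?_)
    change h' (b.coord i (X ε z) / ε) * _ = _
    rw [hcoord ε hε z]
  -- The limit is written over the same product space: the normal factor integrates to 1, and the
  -- product of indicators singles out the facet up to a null set.
  have hlim : ∫ x, F x ∂surf (facet b i) = ∫ z : ℝ × (Submodule.span ℝ {ν})ᗮ, h' z.1 *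
      ((∏ j ∈ Finset.univ.erase i, if 0 < b.coord j (planeMap p ν z.2) then 1 else 0) *
        F (planeMap p ν z.2)) ∂(volume.prod volume) := by
    rw [integral_prod_mul h' (fun w : (Submodule.span ℝ {ν})ᗮ =>
      (∏ j ∈ Finset.univ.erase i, if 0 < b.coord j (planeMap p ν w) then (1 : ℝ) else 0) *
        F (planeMap p ν w)), integral_deriv_smoothTransition, one_mul, surf_facet b hm i hp,
      (isometry_planeMap p ν).isClosedEmbedding.measurableEmbedding.integral_map,
      ← integral_indicator ((isometry_planeMap p ν).continuous.measurable
        (isClosed_facet b i).measurableSet)]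
    refine integral_congr_ae ?_
    have hae : ∀ᵐ w : (Submodule.span ℝ {ν})ᗮ, ∀ j, j ≠ i → b.coord j (planeMap p ν w) ≠ 0 := by
      rw [ae_all_iff]
      intro j
      by_cases hj : j = i
      · simp [hj]
      · have := volume_coord_planeMap b i j hj hp
        rw [ae_iff]
        simpa [hj] using this
    filter_upwards [hae] with w hw
    by_cases hmem : planeMap p ν w ∈ facet b i
    · rw [indicator_of_mem (by exact hmem), Finset.prod_eq_one, one_mul]
      intro j hj
      rw [if_pos ((hmem.1 j).lt_of_ne' (hw j (Finset.ne_of_mem_erase hj)))]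
    · rw [indicator_of_notMem (by exact hmem)]
      have : ∃ j, j ≠ i ∧ b.coord j (planeMap p ν w) < 0 := by
        by_contra! hcon
        refine hmem ⟨fun j => ?_, coord_planeMap b i hp w⟩
        by_cases hj : j = i
        · rw [hj]; exact (coord_planeMap b i hp w).ge
        · exact hcon j hj
      obtain ⟨j, hj, hneg⟩ := this
      rw [Finset.prod_eq_zero (Finset.mem_erase.2 ⟨hj, Finset.mem_univ j⟩) (if_neg hneg.not_gt),
        zero_mul]
  rw [hlim]
  refine Tendsto.congr' (f₁ := fun ε => ∫ z, h' z.1 *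
    (cutoff b (Finset.univ.erase i) ε (X ε z) * F (X ε z)) ∂(volume.prod volume)) ?_ ?_
  · filter_upwards [self_mem_nhdsWithin] with ε hε using (heq ε hε).symm
  obtain ⟨M, hM⟩ := (isCompact_convexHull_range b).exists_bound_of_continuousOn hF.continuousOn
  obtain ⟨R, hR⟩ := (isCompact_convexHull_range b).isBounded.subset_closedBall p
  -- Where the integrand does not vanish, `z.1 > 0` and the other coordinates are positive. Then `X
  -- ε z` lies in the simplex, so `F` is bounded by `M` and `z.2` by `R`.
  refine tendsto_integral_filter_of_dominated_convergence
    (fun z => ‖h' z.1‖ * (Metric.closedBall 0 R).indicator (fun _ => |M|) z.2) ?_ ?_ ?_ ?_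
  · refine Eventually.of_forall fun ε => Continuous.aestronglyMeasurable ?_
    exact (continuous_deriv_smoothTransition.comp continuous_fst).mul
      (((continuous_cutoff b _ ε).comp (hXc ε)).mul (hF.comp (hXc ε)))
  · filter_upwards [self_mem_nhdsWithin] with ε hε
    refine Eventually.of_forall fun z => ?_
    rw [norm_mul]
    by_cases hz : h' z.1 = 0
    · simp [hz]
    refine mul_le_mul_of_nonneg_left ?_ (norm_nonneg _)
    by_cases hcut : cutoff b (Finset.univ.erase i) ε (X ε z) = 0
    · rw [hcut, zero_mul, norm_zero]
      exact indicator_nonneg (fun _ _ => abs_nonneg _) _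
    have hz0 : 0 < z.1 := by
      by_contra hneg
      exact hz (deriv_smoothTransition_eq_zero (Or.inl (not_lt.1 hneg)))
    have hK : X ε z ∈ convexHull ℝ (range b) := by
      rw [convexHull_eq_coord]
      intro j
      by_cases hj : j = i
      · subst hj
        have := hcoord ε hε z
        rw [div_eq_iff (ne_of_gt hε)] at this
        rw [this]
        exact mul_nonneg hz0.le (le_of_lt hε)
      · exact (coord_pos_of_cutoff_ne_zero b hε hcut
          (Finset.mem_erase.2 ⟨hj, Finset.mem_univ j⟩)).le
    have hball : z.2 ∈ Metric.closedBall (0 : (Submodule.span ℝ {ν})ᗮ) R := by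
      rw [mem_closedBall_zero_iff]
      refine (norm_le_slabMap (p := p) (ε / ‖coordGrad b i‖ * z.1, z.2)).trans ?_
      rw [← dist_eq_norm]
      exact hR hK
    rw [indicator_of_mem hball, norm_mul, Real.norm_of_nonneg (cutoff_nonneg b _ _ _)]
    refine (mul_le_of_le_one_left (norm_nonneg _) (cutoff_le_one b _ _ _)).trans ?_
    exact (hM _ hK).trans (le_abs_self M)
  · refine Integrable.mul_prod (f := fun s => ‖h' s‖)
      (g := (Metric.closedBall (0 : (Submodule.span ℝ {ν})ᗮ) R).indicator (fun _ => |M|))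
      integrable_deriv_smoothTransition.norm ?_
    rw [integrable_indicator_iff Metric.isClosed_closedBall.measurableSet]
    exact integrableOn_const (isCompact_closedBall _ _).measure_lt_top.ne
  · have hae : ∀ᵐ z : ℝ × (Submodule.span ℝ {ν})ᗮ ∂(volume.prod volume),
        ∀ j ∈ Finset.univ.erase i, b.coord j (planeMap p ν z.2) ≠ 0 := by
      refine Measure.quasiMeasurePreserving_snd.ae (p := fun w =>
        ∀ j ∈ Finset.univ.erase i, b.coord j (planeMap p ν w) ≠ 0) ?_
      rw [ae_all_iff]
      intro j
      by_cases hj : j = i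
      · simp [hj]
      · have := volume_coord_planeMap b i j hj hp
        rw [ae_iff]
        simpa [hj] using this
    filter_upwards [hae] with z hz
    have hX : Tendsto (fun ε => X ε z) (𝓝[>] 0) (𝓝 (planeMap p ν z.2)) := by
      have hc : Continuous fun ε => X ε z := (continuous_slabMap p ν).comp (by fun_prop)
      have := hc.tendsto 0
      simp only [X, slabMap, zero_div, zero_mul, zero_smul, zero_add] at this
      exact this.mono_left nhdsWithin_le_nhds
    exact tendsto_const_nhds.mul ((tendsto_cutoff b hX hz).mul ((hF.tendsto _).comp hX))

/-- The cutoffs take values in [0, 1], vanish off the simplex and tend to its indicator away from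
the frontier, which is null because the simplex is convex. -/
theorem tendsto_integral_cutoff {G : Space m → ℝ} (hG : Continuous G) :
    Tendsto (fun ε => ∫ x, cutoff b Finset.univ ε x * G x) (𝓝[>] 0)
      (𝓝 (∫ x in convexHull ℝ (range b), G x)) := by
  have hK := isCompact_convexHull_range b
  have hfr : volume (frontier (convexHull ℝ (range b))) = 0 :=
    (convex_convexHull ℝ (range b)).addHaar_frontier volume
  rw [← integral_indicator hK.isClosed.measurableSet]
  obtain ⟨M, hM⟩ := hK.exists_bound_of_continuousOn hG.continuousOn
  refine tendsto_integral_filter_of_dominated_convergence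
    ((convexHull ℝ (range b)).indicator fun _ => |M|) ?_ ?_ ?_ ?_
  · exact Eventually.of_forall fun ε => ((continuous_cutoff b _ ε).mul hG).aestronglyMeasurable
  · filter_upwards [self_mem_nhdsWithin] with ε hε
    refine Eventually.of_forall fun x => ?_
    by_cases hcut : cutoff b Finset.univ ε x = 0
    · rw [hcut, zero_mul, norm_zero]
      exact indicator_nonneg (fun _ _ => abs_nonneg _) _
    have hx : x ∈ convexHull ℝ (range b) := by
      rw [convexHull_eq_coord]
      exact fun j => (coord_pos_of_cutoff_ne_zero b hε hcut (Finset.mem_univ j)).le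
    rw [indicator_of_mem hx, norm_mul, Real.norm_of_nonneg (cutoff_nonneg b _ _ _)]
    refine (mul_le_of_le_one_left (norm_nonneg _) (cutoff_le_one b _ _ _)).trans ?_
    exact (hM _ hx).trans (le_abs_self M)
  · rw [integrable_indicator_iff hK.isClosed.measurableSet]
    exact integrableOn_const hK.measure_lt_top.ne
  · filter_upwards [compl_mem_ae_iff.2 hfr] with x hx
    by_cases hmem : x ∈ convexHull ℝ (range b)
    · have hpos : ∀ i, 0 < b.coord i x := by
        have : x ∈ interior (convexHull ℝ (range b)) := by
          by_contra h
          exact hx ⟨subset_closure hmem, h⟩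
        rwa [b.interior_convexHull] at this
      rw [indicator_of_mem hmem]
      have := (tendsto_cutoff b (s := Finset.univ) (q := fun _ => x) (x := x)
        tendsto_const_nhds fun i _ => (hpos i).ne').mul_const (G x)
      simpa [hpos] using this
    · rw [indicator_of_notMem hmem]
      refine tendsto_const_nhds.congr' ?_
      filter_upwards [self_mem_nhdsWithin] with ε hε
      have : cutoff b Finset.univ ε x = 0 := by
        by_contra hcut
        refine hmem ?_
        rw [convexHull_eq_coord]
        exact fun j => (coord_pos_of_cutoff_ne_zero b hε hcut (Finset.mem_univ j)).le
      rw [this, zero_mul]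

theorem hasCompactSupport_cutoff {ε : ℝ} (hε : 0 < ε) :
    HasCompactSupport (cutoff b Finset.univ ε) := by
  refine HasCompactSupport.of_support_subset_isCompact (isCompact_convexHull_range b) ?_
  intro x hx
  rw [convexHull_eq_coord]
  exact fun j => (coord_pos_of_cutoff_ne_zero b hε hx (Finset.mem_univ j)).le

/-- The cutoff is supported in the simplex, so integration by parts over all of space has no
boundary term. The product rule then yields one layer integral per facet. -/
theorem integral_cutoff_mul_fderiv [DecidableEq ι] {F : Space m → ℝ} (hF : ContDiff ℝ 1 F)
    (a : Space m) {ε : ℝ} (hε : 0 < ε) :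
    ∫ x, cutoff b Finset.univ ε x * fderiv ℝ F x a =
      -∑ i, inner ℝ (coordGrad b i) a * (ε⁻¹ * ∫ x, deriv Real.smoothTransition
        (b.coord i x / ε) * (cutoff b (Finset.univ.erase i) ε x * F x)) := by
  have hcs := hasCompactSupport_cutoff b hε
  have hc := continuous_cutoff b Finset.univ ε
  have hF' : Continuous fun x => fderiv ℝ F x a :=
    (hF.continuous_fderiv (by simp)).clm_apply continuous_const
  have hterm : ∀ i, Continuous fun x => deriv Real.smoothTransition (b.coord i x / ε) *
      (cutoff b (Finset.univ.erase i) ε x * F x) := fun i =>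
    (continuous_deriv_smoothTransition.comp ((continuous_coord b i).div_const ε)).mul
      ((continuous_cutoff b _ ε).mul hF.continuous)
  have hsupp : ∀ i, HasCompactSupport fun x => deriv Real.smoothTransition (b.coord i x / ε) *
      (cutoff b (Finset.univ.erase i) ε x * F x) := by
    intro i
    refine HasCompactSupport.of_support_subset_isCompact (isCompact_convexHull_range b) ?_
    intro x hx
    rw [convexHull_eq_coord]
    intro j
    by_cases hj : j = i
    · subst hj
      by_contra hneg
      refine left_ne_zero_of_mul hx (deriv_smoothTransition_eq_zero (Or.inl ?_))
      exact div_nonpos_of_nonpos_of_nonneg (not_le.1 hneg).le hε.le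
    · exact (coord_pos_of_cutoff_ne_zero b hε (left_ne_zero_of_mul (right_ne_zero_of_mul hx))
        (Finset.mem_erase.2 ⟨hj, Finset.mem_univ j⟩)).le
  have hderiv : ∀ x, fderiv ℝ (cutoff b Finset.univ ε) x a * F x =
      ∑ i, inner ℝ (coordGrad b i) a * (ε⁻¹ * (deriv Real.smoothTransition
        (b.coord i x / ε) * (cutoff b (Finset.univ.erase i) ε x * F x))) := by
    intro x
    rw [(hasFDerivAt_cutoff b ε x).fderiv, sum_apply, Finset.sum_mul]
    refine Finset.sum_congr rfl fun i _ => ?_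
    simp only [smul_apply, innerSL_apply_apply, smul_eq_mul]
    ring
  have hint : ∀ i, Integrable fun x => inner ℝ (coordGrad b i) a *
      (ε⁻¹ * (deriv Real.smoothTransition (b.coord i x / ε) *
        (cutoff b (Finset.univ.erase i) ε x * F x))) := fun i =>
    (((hterm i).integrable_of_hasCompactSupport (hsupp i)).const_mul _).const_mul _
  rw [integral_mul_fderiv_eq_neg_fderiv_mul_of_integrable]
  · simp_rw [hderiv]
    rw [integral_finsetSum _ fun i _ => hint i]
    simp_rw [integral_const_mul]
  · simp_rw [hderiv]
    exact integrable_finsetSum _ fun i _ => hint i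
  · exact (hc.mul hF').integrable_of_hasCompactSupport hcs.mul_right
  · exact (hc.mul hF.continuous).integrable_of_hasCompactSupport hcs.mul_right
  · exact fun x _ => (hasFDerivAt_cutoff b ε x).differentiableAt
  · exact fun x _ => hF.differentiable (by simp) x

theorem integrable_surf_frontier_of_continuous (hm : 0 < m) {F : Space m → ℝ}
    (hF : Continuous F) : Integrable F (surf (frontier (convexHull ℝ (range b)))) := by
  have hK := isCompact_convexHull_range b
  have := isFiniteMeasure_surf_frontier b hm
  have hfr : IsCompact (frontier (convexHull ℝ (range b))) :=
    hK.of_isClosed_subset isClosed_frontier (hK.isClosed.frontier_subset)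
  obtain ⟨M, hM⟩ := hfr.exists_bound_of_continuousOn hF.continuousOn
  refine Integrable.of_bound hF.aestronglyMeasurable M ?_
  filter_upwards [ae_restrict_mem isClosed_frontier.measurableSet] with x hx using hM x hx

/-- The divergence theorem on a simplex. -/
theorem setIntegral_fderiv_convexHull (hm : 0 < m) {F : Space m → ℝ} (hF : ContDiff ℝ 1 F)
    (a : Space m) :
    ∫ x in convexHull ℝ (range b), fderiv ℝ F x a =
      ∫ x, F x * inner ℝ (outerNormal (convexHull ℝ (range b)) x) a
        ∂surf (frontier (convexHull ℝ (range b))) := by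
  classical
  rw [integral_mul_outerNormal b hm (integrable_surf_frontier_of_continuous b hm hF.continuous)]
  refine tendsto_nhds_unique (tendsto_integral_cutoff b
    ((hF.continuous_fderiv (by simp)).clm_apply continuous_const)) ?_
  have hlim : Tendsto (fun ε => -∑ i, inner ℝ (facetNormal b i) a * (‖coordGrad b i‖ * ε⁻¹ *
      ∫ x, deriv Real.smoothTransition (b.coord i x / ε) *
        (cutoff b (Finset.univ.erase i) ε x * F x))) (𝓝[>] 0)
      (𝓝 (-∑ i, inner ℝ (facetNormal b i) a * ∫ x, F x ∂surf (facet b i))) :=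
    (tendsto_finsetSum _ fun i _ => (tendsto_layer b hm i hF.continuous).const_mul _).neg
  refine hlim.congr' ?_
  filter_upwards [self_mem_nhdsWithin] with ε hε
  rw [integral_cutoff_mul_fderiv b hF a hε]
  congr 1
  refine Finset.sum_congr rfl fun i _ => ?_
  conv_rhs => rw [coordGrad_eq b hm i, real_inner_smul_left]
  ring

end Simplex

/-! ### Limits of integrals of products in `L²` -/

section SquareIntegrable

variable {α : Type*} {mα : MeasurableSpace α} {μ : Measure α}

theorem norm_toLp_sq {f : α → ℝ} (hf : MemLp f 2 μ) : ‖hf.toLp f‖ ^ 2 = ∫ x, f x ^ 2 ∂μ := by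
  rw [← real_inner_self_eq_norm_sq, L2.inner_def]
  refine integral_congr_ae ?_
  filter_upwards [hf.coeFn_toLp] with x hx
  rw [hx, real_inner_self_eq_norm_sq, Real.norm_eq_abs, sq_abs]

theorem inner_toLp {f g : α → ℝ} (hf : MemLp f 2 μ) (hg : MemLp g 2 μ) :
    inner ℝ (hf.toLp f) (hg.toLp g) = ∫ x, f x * g x ∂μ := by
  rw [L2.inner_def]
  refine integral_congr_ae ?_
  filter_upwards [hf.coeFn_toLp, hg.coeFn_toLp] with x hx hy
  rw [hx, hy, RCLike.inner_apply, conj_trivial, mul_comm]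

theorem tendsto_integral_mul {f g : ℕ → α → ℝ} {F G : α → ℝ} (hf : ∀ k, MemLp (f k) 2 μ)
    (hg : ∀ k, MemLp (g k) 2 μ) (hF : MemLp F 2 μ) (hG : MemLp G 2 μ)
    (hfF : Tendsto (fun k => eLpNorm (fun x => f k x - F x) 2 μ) atTop (𝓝 0))
    (hgG : Tendsto (fun k => eLpNorm (fun x => g k x - G x) 2 μ) atTop (𝓝 0)) :
    Tendsto (fun k => ∫ x, f k x * g k x ∂μ) atTop (𝓝 (∫ x, F x * G x ∂μ)) := by
  have h1 := (Lp.tendsto_Lp_iff_tendsto_eLpNorm'' f hf F hF).2 hfF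
  have h2 := (Lp.tendsto_Lp_iff_tendsto_eLpNorm'' g hg G hG).2 hgG
  have := h1.inner (𝕜 := ℝ) h2
  simpa only [inner_toLp] using this

end SquareIntegrable

/-! ### Trace inequality and integration by parts in `H¹` of a simplex -/

section Simplex

set_option linter.unusedSectionVars false

variable {m : ℕ} {ι : Type*} [Fintype ι] (b : AffineBasis ι ℝ (Space m))

theorem memLp_vol_of_continuous {F : Space m → ℝ} (hF : Continuous F) :
    MemLp F 2 (vol (convexHull ℝ (range b))) := by
  have hK := isCompact_convexHull_range b
  have : IsFiniteMeasure (vol (convexHull ℝ (range b))) :=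
    ⟨by rw [Measure.restrict_apply_univ]; exact hK.measure_lt_top⟩
  obtain ⟨M, hM⟩ := hK.exists_bound_of_continuousOn hF.continuousOn
  refine MemLp.of_bound hF.aestronglyMeasurable M ?_
  filter_upwards [ae_restrict_mem hK.isClosed.measurableSet] with x hx using hM x hx

theorem memLp_surf_of_continuous (hm : 0 < m) {F : Space m → ℝ} (hF : Continuous F) :
    MemLp F 2 (surf (frontier (convexHull ℝ (range b)))) :=
  (memLp_two_iff_integrable_sq hF.aestronglyMeasurable).2
    (integrable_surf_frontier_of_continuous b hm (hF.pow 2))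

theorem integrable_vol_of_continuous {F : Space m → ℝ} (hF : Continuous F) :
    Integrable F (vol (convexHull ℝ (range b))) :=
  hF.continuousOn.integrableOn_compact (isCompact_convexHull_range b)

/-- Integration by parts on a simplex for continuously differentiable functions. -/
theorem setIntegral_mul_fderiv_add (hm : 0 < m) {F G : Space m → ℝ} (hF : ContDiff ℝ 1 F)
    (hG : ContDiff ℝ 1 G) (a : Space m) :
    (∫ x in convexHull ℝ (range b), F x * fderiv ℝ G x a) +
        ∫ x in convexHull ℝ (range b), fderiv ℝ F x a * G x =
      ∫ x, F x * (G x * inner ℝ (outerNormal (convexHull ℝ (range b)) x) a)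
        ∂surf (frontier (convexHull ℝ (range b))) := by
  have hcF : Continuous fun x => fderiv ℝ F x a :=
    (hF.continuous_fderiv (by simp)).clm_apply continuous_const
  have hcG : Continuous fun x => fderiv ℝ G x a :=
    (hG.continuous_fderiv (by simp)).clm_apply continuous_const
  rw [← integral_add (f := fun x => F x * fderiv ℝ G x a) (g := fun x => fderiv ℝ F x a * G x)
    (integrable_vol_of_continuous b (hF.continuous.mul hcG))
    (integrable_vol_of_continuous b (hcF.mul hG.continuous))]
  simp_rw [← mul_assoc]
  rw [← setIntegral_fderiv_convexHull b hm (hF.mul hG) a]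
  refine integral_congr_ae (Eventually.of_forall fun x => ?_)
  simp only
  rw [fderiv_fun_mul (hF.differentiable (by simp) x) (hG.differentiable (by simp) x)]
  simp only [add_apply, smul_apply, smul_eq_mul]
  ring

theorem exists_closedBall_subset : ∃ x₀ ρ, 0 < ρ ∧
    Metric.closedBall x₀ ρ ⊆ convexHull ℝ (range b) := by
  obtain ⟨ρ, hρ, h⟩ := Metric.nhds_basis_closedBall.mem_iff.1
    (mem_interior_iff_mem_nhds.1 b.centroid_mem_interior_convexHull)
  exact ⟨_, ρ, hρ, h⟩

/-- The default value 0 of `outerNormal` is not a unit vector. Norm 1 almost everywhere therefore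
shows that the defining half-space property holds there. -/
theorem norm_outerNormal_ae (hm : 0 < m) :
    ∀ᵐ x ∂surf (frontier (convexHull ℝ (range b))), ‖outerNormal (convexHull ℝ (range b)) x‖ = 1 ∧
      ∀ y ∈ convexHull ℝ (range b), inner ℝ (outerNormal (convexHull ℝ (range b)) x) (y - x) ≤ 0 := by
  have h : ∀ᵐ x ∂surf (frontier (convexHull ℝ (range b))),
      ‖outerNormal (convexHull ℝ (range b)) x‖ = 1 := by
    rw [surf_frontier b hm, Measure.ae_sum_iff]
    intro i
    filter_upwards [outerNormal_ae_facet b hm i] with x hx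
    rw [hx, norm_neg, norm_facetNormal b hm]
  filter_upwards [h] with x hx
  refine ⟨hx, ?_⟩
  rw [outerNormal] at hx ⊢
  split_ifs at hx ⊢ with hex
  · exact hex.choose_spec.1.2
  · simp at hx

/-- The trace inequality on a simplex. -/
theorem exists_trace_inequality (hm : 0 < m) : ∃ C : ℝ, 0 ≤ C ∧ ∀ F : Space m → ℝ, ContDiff ℝ 1 F →
    ∫ x, F x ^ 2 ∂surf (frontier (convexHull ℝ (range b))) ≤
      C * ∑ μ : Fin m, ((∫ x in convexHull ℝ (range b), F x ^ 2) +
        ∫ x in convexHull ℝ (range b), fderiv ℝ F x (EuclideanSpace.single μ 1) ^ 2) := by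
  obtain ⟨x₀, ρ, hρ, hball⟩ := exists_closedBall_subset b
  obtain ⟨R, hR0, hR⟩ := (isCompact_convexHull_range b).isBounded.subset_closedBall_lt 0 x₀
  set K := convexHull ℝ (range b) with hK
  -- The divergence theorem is applied to `F²` times the field `x - x₀`. The normal component of
  -- this field is at least `ρ` on the boundary, and its length is at most `R` on the simplex.
  refine ⟨ρ⁻¹ * (R + 1), by positivity, fun F hF => ?_⟩
  have hFs : Continuous fun x => F x ^ 2 := hF.continuous.pow 2
  have hcoord : ∀ μ : Fin m, ContDiff ℝ 1 fun x : Space m => (x - x₀) μ := fun μ => by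
    have : ContDiff ℝ 1 fun x : Space m => (EuclideanSpace.proj μ : Space m →L[ℝ] ℝ) (x - x₀) := by
      fun_prop
    exact this
  have hcd : ∀ μ : Fin m, Continuous fun x => fderiv ℝ F x (EuclideanSpace.single μ 1) := fun μ =>
    (hF.continuous_fderiv (by simp)).clm_apply continuous_const
  have hone : ∀ μ : Fin m, ∀ x, fderiv ℝ (fun x : Space m => (x - x₀) μ) x
      (EuclideanSpace.single μ 1) = 1 := by
    intro μ x
    have : HasFDerivAt (fun x : Space m => (EuclideanSpace.proj μ : Space m →L[ℝ] ℝ) (x - x₀))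
        (EuclideanSpace.proj μ : Space m →L[ℝ] ℝ) x :=
      (EuclideanSpace.proj μ : Space m →L[ℝ] ℝ).hasFDerivAt.comp x ((hasFDerivAt_id x).sub_const x₀)
    have h2 : fderiv ℝ (fun x : Space m => (x - x₀) μ) x =
      (EuclideanSpace.proj μ : Space m →L[ℝ] ℝ) := this.fderiv
    rw [h2]
    simp
  have hsq : ∀ μ : Fin m, ∀ x, fderiv ℝ (fun x => F x ^ 2) x (EuclideanSpace.single μ 1) =
      2 * F x * fderiv ℝ F x (EuclideanSpace.single μ 1) := by
    intro μ x
    rw [((hF.differentiable (by simp) x).hasFDerivAt.pow 2).fderiv]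
    simp
  have hint : ∀ μ : Fin m, Integrable (fun x => F x ^ 2 * ((x - x₀) μ *
      inner ℝ (outerNormal K x) (EuclideanSpace.single μ 1))) (surf (frontier K)) := by
    intro μ
    simp_rw [← mul_assoc]
    refine (integrable_surf_frontier_of_continuous b hm
      (hFs.mul (hcoord μ).continuous)).mul_bdd (c := 1)
      ((aestronglyMeasurable_outerNormal b hm).inner aestronglyMeasurable_const) ?_
    refine Eventually.of_forall fun x => (norm_inner_le_norm _ _).trans ?_
    simpa using norm_outerNormal_le K x
  have hkey : ρ * ∫ x, F x ^ 2 ∂surf (frontier K) ≤ ∑ μ : Fin m,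
      ∫ x, F x ^ 2 * ((x - x₀) μ * inner ℝ (outerNormal K x) (EuclideanSpace.single μ 1))
        ∂surf (frontier K) := by
    rw [← integral_const_mul, ← integral_finsetSum _ fun μ _ => hint μ]
    refine integral_mono_ae ((integrable_surf_frontier_of_continuous b hm hFs).const_mul ρ)
      (integrable_finsetSum _ fun μ _ => hint μ) ?_
    filter_upwards [norm_outerNormal_ae b hm] with x hx
    rw [← Finset.mul_sum, mul_comm ρ]
    refine mul_le_mul_of_nonneg_left ?_ (sq_nonneg _)
    -- The point `x₀ + ρ N` of the inscribed ball belongs to the simplex, hence lies in the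
    -- supporting half space at `x`; this gives ⟪N, x − x₀⟫ ≥ ρ.
    have h1 := hx.2 (x₀ + ρ • outerNormal K x) (hball (by
      rw [Metric.mem_closedBall, dist_eq_norm, add_sub_cancel_left, norm_smul, hx.1,
        Real.norm_of_nonneg hρ.le, mul_one]))
    rw [show x₀ + ρ • outerNormal K x - x = ρ • outerNormal K x - (x - x₀) by abel,
      inner_sub_right, real_inner_smul_right, real_inner_self_eq_norm_sq, hx.1] at h1
    have h2 : ∑ μ : Fin m, (x - x₀) μ * inner ℝ (outerNormal K x) (EuclideanSpace.single μ 1) =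
        inner ℝ (outerNormal K x) (x - x₀) := by
      rw [PiLp.inner_apply]
      refine Finset.sum_congr rfl fun μ _ => ?_
      rw [EuclideanSpace.inner_single_right, RCLike.inner_apply, conj_trivial, one_mul]
    rw [h2]
    linarith
  have hterm : ∀ μ : Fin m, ∫ x, F x ^ 2 * ((x - x₀) μ *
      inner ℝ (outerNormal K x) (EuclideanSpace.single μ 1)) ∂surf (frontier K) ≤
      (R + 1) * ((∫ x in K, F x ^ 2) +
        ∫ x in K, fderiv ℝ F x (EuclideanSpace.single μ 1) ^ 2) := by
    intro μ
    rw [← setIntegral_mul_fderiv_add b hm (hF.pow 2) (hcoord μ) (EuclideanSpace.single μ 1),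
      ← integral_add, ← integral_add, ← integral_const_mul]
    rotate_left
    · exact integrable_vol_of_continuous b hFs
    · exact integrable_vol_of_continuous b ((hcd μ).pow 2)
    · simp_rw [hone]
      exact integrable_vol_of_continuous b (hFs.mul continuous_const)
    · simp_rw [hsq]
      exact integrable_vol_of_continuous b
        (((continuous_const.mul hF.continuous).mul (hcd μ)).mul (hcoord μ).continuous)
    refine setIntegral_mono_on ?_ ?_ (isCompact_convexHull_range b).isClosed.measurableSet ?_
    · simp_rw [hone, hsq]
      exact integrable_vol_of_continuous b ((hFs.mul continuous_const).add
        (((continuous_const.mul hF.continuous).mul (hcd μ)).mul (hcoord μ).continuous))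
    · exact integrable_vol_of_continuous b (continuous_const.mul (hFs.add ((hcd μ).pow 2)))
    intro x hx
    rw [hone, hsq]
    have h1 : |(x - x₀) μ| ≤ R := by
      have h2 := hR hx
      rw [Metric.mem_closedBall, dist_eq_norm] at h2
      exact (PiLp.norm_apply_le (x - x₀) μ).trans h2
    set d := fderiv ℝ F x (EuclideanSpace.single μ 1)
    have h3 : 2 * F x * d * (x - x₀) μ ≤ R * (F x ^ 2 + d ^ 2) := by
      calc 2 * F x * d * (x - x₀) μ ≤ |2 * F x * d * (x - x₀) μ| := le_abs_self _
        _ = |2 * F x * d| * |(x - x₀) μ| := abs_mul _ _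
        _ ≤ (F x ^ 2 + d ^ 2) * R := by
          refine mul_le_mul ?_ h1 (abs_nonneg _) (by positivity)
          rw [abs_le]
          constructor <;> nlinarith [sq_nonneg (F x + d), sq_nonneg (F x - d)]
        _ = R * (F x ^ 2 + d ^ 2) := mul_comm _ _
    nlinarith [sq_nonneg d]
  rw [mul_assoc, Finset.mul_sum, le_inv_mul_iff₀ hρ]
  exact hkey.trans (Finset.sum_le_sum fun μ _ => hterm μ)

/-- Applied to differences, the trace inequality makes a sequence that converges in `H¹` Cauchy in
`L²` of the boundary, and completeness supplies the trace. -/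
theorem exists_isTrace_of_approx (hm : 0 < m) {K : Set (Space m)}
    (hK : K = convexHull ℝ (range b)) (f : Lp ℝ 2 (vol K))
    (φ : ℕ → Space m → ℝ) (hφ : ∀ k, ContDiff ℝ ∞ (φ k))
    (hf : Tendsto (fun k => eLpNorm (fun x => φ k x - f x) 2 (vol K))
      atTop (𝓝 0))
    (hg : ∀ μ : Fin m, Tendsto (fun k => eLpNorm (fun x =>
      fderiv ℝ (φ k) x (EuclideanSpace.single μ 1) -
        weakPartial K μ f x) 2 (vol K))
      atTop (𝓝 0)) :
    ∃ g, IsTrace K f g := by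
  obtain ⟨C, hC, htr⟩ := exists_trace_inequality b hm
  rw [← hK] at htr
  have hφ1 : ∀ k, ContDiff ℝ 1 (φ k) := fun k => (hφ k).of_le (by simp)
  have hd : ∀ k (μ : Fin m), Continuous fun x => fderiv ℝ (φ k) x (EuclideanSpace.single μ 1) :=
    fun k μ => ((hφ1 k).continuous_fderiv (by simp)).clm_apply continuous_const
  have m0 : ∀ k, MemLp (φ k) 2 (vol K) := fun k => hK ▸ memLp_vol_of_continuous b (hφ k).continuous
  have m1 : ∀ k μ, MemLp (fun x => fderiv ℝ (φ k) x (EuclideanSpace.single μ 1)) 2 (vol K) :=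
    fun k μ => hK ▸ memLp_vol_of_continuous b (hd k μ)
  have ms : ∀ k, MemLp (φ k) 2 (surf (frontier K)) :=
    fun k => hK ▸ memLp_surf_of_continuous b hm (hφ k).continuous
  have t0 := (Lp.tendsto_Lp_iff_tendsto_eLpNorm'' φ m0 f (Lp.memLp f)).2 hf
  have t1 := fun μ => (Lp.tendsto_Lp_iff_tendsto_eLpNorm''
    (fun k x => fderiv ℝ (φ k) x (EuclideanSpace.single μ 1)) (fun k => m1 k μ)
    (weakPartial K μ f) (Lp.memLp _)).2 (hg μ)
  have hcauchy : CauchySeq fun k => (ms k).toLp (φ k) := by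
    have hc := (t0.prodMk_nhds (tendsto_pi_nhds.2 t1)).cauchySeq
    rw [Metric.cauchySeq_iff] at hc ⊢
    intro ε hε
    -- The trace inequality bounds the distance of restrictions by √(2mC) times the `H¹` distance
    -- `δ`; adding 1 keeps the denominator positive.
    obtain ⟨N, hN⟩ := hc (ε / (√(C * (m * 2)) + 1)) (by positivity)
    refine ⟨N, fun k hk l hl => ?_⟩
    set δ := dist ((m0 k).toLp (φ k), fun μ => (m1 k μ).toLp _)
      ((m0 l).toLp (φ l), fun μ => (m1 l μ).toLp _) with hδ
    have hδ0 : 0 ≤ δ := dist_nonneg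
    have hδ1 : δ < ε / (√(C * (m * 2)) + 1) := hN k hk l hl
    have e0 : ∫ x in K, (φ k - φ l) x ^ 2 ≤ δ ^ 2 := by
      rw [← norm_toLp_sq ((m0 k).sub (m0 l)), MemLp.toLp_sub (m0 k) (m0 l), ← dist_eq_norm]
      exact pow_le_pow_left₀ dist_nonneg (le_max_left _ _) 2
    have e1 : ∀ μ, ∫ x in K, fderiv ℝ (φ k - φ l) x (EuclideanSpace.single μ 1) ^ 2 ≤ δ ^ 2 := by
      intro μ
      have : ∀ x, fderiv ℝ (φ k - φ l) x (EuclideanSpace.single μ 1) =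
          ((fun x => fderiv ℝ (φ k) x (EuclideanSpace.single μ 1)) -
            fun x => fderiv ℝ (φ l) x (EuclideanSpace.single μ 1)) x := by
        intro x
        rw [fderiv_sub ((hφ1 k).differentiable (by simp) x) ((hφ1 l).differentiable (by simp) x)]
        rfl
      simp_rw [this]
      rw [← norm_toLp_sq ((m1 k μ).sub (m1 l μ)), MemLp.toLp_sub, ← dist_eq_norm]
      refine pow_le_pow_left₀ dist_nonneg (le_trans ?_ (le_max_right _ _)) 2
      exact dist_le_pi_dist (fun μ => (m1 k μ).toLp _) (fun μ => (m1 l μ).toLp _) μ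
    have h2 : dist ((ms k).toLp (φ k)) ((ms l).toLp (φ l)) ^ 2 ≤ (C * (m * 2)) * δ ^ 2 := by
      rw [dist_eq_norm, ← MemLp.toLp_sub, norm_toLp_sq]
      refine (htr _ ((hφ1 k).sub (hφ1 l))).trans ?_
      rw [mul_assoc]
      refine mul_le_mul_of_nonneg_left ?_ hC
      refine (Finset.sum_le_sum fun μ _ => add_le_add e0 (e1 μ)).trans ?_
      simp only [Finset.sum_const, Finset.card_univ, Fintype.card_fin, nsmul_eq_mul]
      linarith
    have h3 : dist ((ms k).toLp (φ k)) ((ms l).toLp (φ l)) ≤ √(C * (m * 2)) * δ := by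
      rw [← Real.sqrt_sq hδ0, ← Real.sqrt_mul (by positivity)]
      exact Real.le_sqrt_of_sq_le h2
    rw [lt_div_iff₀ (by positivity)] at hδ1
    linarith
  obtain ⟨g, hgl⟩ := cauchySeq_tendsto_of_complete hcauchy
  refine ⟨g, φ, hφ, hf, hg, ?_⟩
  rw [← Lp.toLp_coeFn g (Lp.memLp g)] at hgl
  exact (Lp.tendsto_Lp_iff_tendsto_eLpNorm'' φ ms g (Lp.memLp g)).1 hgl

theorem memLp_mul_outerNormal (hm : 0 < m) {F : Space m → ℝ}
    (hF : MemLp F 2 (surf (frontier (convexHull ℝ (range b))))) (a : Space m) :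
    MemLp (fun x => F x * inner ℝ (outerNormal (convexHull ℝ (range b)) x) a) 2
      (surf (frontier (convexHull ℝ (range b)))) := by
  refine hF.of_le_mul (c := ‖a‖) (hF.1.mul
    ((aestronglyMeasurable_outerNormal b hm).inner aestronglyMeasurable_const)) ?_
  refine Eventually.of_forall fun x => ?_
  rw [norm_mul, mul_comm]
  refine mul_le_mul_of_nonneg_right ((norm_inner_le_norm _ _).trans ?_) (norm_nonneg _)
  exact mul_le_of_le_one_left (norm_nonneg _) (norm_outerNormal_le _ _)

/-- Integration by parts on a simplex for functions in `H¹`. -/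
theorem setIntegral_mul_weakPartial_add (hm : 0 < m) {K : Set (Space m)}
    (hK : K = convexHull ℝ (range b))
    {f g : Lp ℝ 2 (vol K)}
    {f' g' : Lp ℝ 2 (surf (frontier K))}
    (hf : IsTrace K f f') (hg : IsTrace K g g')
    (μ : Fin m) :
    (∫ x in K, f x * weakPartial K μ g x) +
        ∫ x in K, weakPartial K μ f x * g x =
      ∫ x, f' x * (g' x * outerNormal K x μ)
        ∂surf (frontier K) := by
  obtain ⟨φ, hφ, hφ0, hφ1, hφs⟩ := hf
  obtain ⟨ψ, hψ, hψ0, hψ1, hψs⟩ := hg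
  have c1 : ∀ {η : ℕ → Space m → ℝ}, (∀ k, ContDiff ℝ ∞ (η k)) → ∀ k, ContDiff ℝ 1 (η k) :=
    fun h k => (h k).of_le (by simp)
  have m0 : ∀ {η : ℕ → Space m → ℝ}, (∀ k, ContDiff ℝ ∞ (η k)) → ∀ k, MemLp (η k) 2 (vol K) :=
    fun h k => hK ▸ memLp_vol_of_continuous b (h k).continuous
  have m1 : ∀ {η : ℕ → Space m → ℝ}, (∀ k, ContDiff ℝ ∞ (η k)) → ∀ k,
      MemLp (fun x => fderiv ℝ (η k) x (EuclideanSpace.single μ 1)) 2 (vol K) :=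
    fun h k => hK ▸ memLp_vol_of_continuous b
      (((c1 h k).continuous_fderiv (by simp)).clm_apply continuous_const)
  have ms : ∀ {η : ℕ → Space m → ℝ}, (∀ k, ContDiff ℝ ∞ (η k)) → ∀ k,
      MemLp (η k) 2 (surf (frontier K)) :=
    fun h k => hK ▸ memLp_surf_of_continuous b hm (h k).continuous
  have hN : ∀ x, inner ℝ (outerNormal K x) (EuclideanSpace.single μ (1 : ℝ)) =
      outerNormal K x μ := by
    intro x
    rw [EuclideanSpace.inner_single_right]
    simp
  have hnle : ∀ x, ‖outerNormal K x μ‖ ≤ 1 := fun x =>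
    (PiLp.norm_apply_le _ μ).trans (norm_outerNormal_le K x)
  have mN : ∀ {F : Space m → ℝ}, MemLp F 2 (surf (frontier K)) →
      MemLp (fun x => F x * outerNormal K x μ) 2 (surf (frontier K)) := by
    intro F hF
    have := memLp_mul_outerNormal b hm (hK ▸ hF) (EuclideanSpace.single μ 1)
    rw [← hK] at this
    simpa only [hN] using this
  have hψN : Tendsto (fun k => eLpNorm (fun x => ψ k x * outerNormal K x μ -
      g' x * outerNormal K x μ) 2 (surf (frontier K))) atTop (𝓝 0) := by
    refine tendsto_of_tendsto_of_tendsto_of_le_of_le tendsto_const_nhds hψs (fun _ => zero_le)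
      fun k => eLpNorm_mono fun x => ?_
    rw [← sub_mul, norm_mul]
    exact mul_le_of_le_one_right (norm_nonneg _) (hnle x)
  have l1 := tendsto_integral_mul (m0 hφ) (m1 hψ) (Lp.memLp f) (Lp.memLp _) hφ0 (hψ1 μ)
  have l2 := tendsto_integral_mul (m1 hφ) (m0 hψ) (Lp.memLp _) (Lp.memLp g) (hφ1 μ) hψ0
  have l3 := tendsto_integral_mul (ms hφ) (fun k => mN (ms hψ k)) (Lp.memLp f')
    (mN (Lp.memLp g')) hφs hψN
  refine tendsto_nhds_unique ((l1.add l2).congr fun k => ?_) l3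
  have := setIntegral_mul_fderiv_add b hm (c1 hφ k) (c1 hψ k) (EuclideanSpace.single μ 1)
  rw [← hK] at this
  rw [this]
  simp_rw [hN]

end Simplex

/-! ### Dilation followed by mollification in `L²` -/

section Mollification

variable {m : ℕ}

theorem sq_lintegral_le {α : Type*} {mα : MeasurableSpace α} {ν : Measure α}
    (hν : ν univ = 1) {g : α → ENNReal} (hg : AEMeasurable g ν) :
    (∫⁻ z, g z ∂ν) ^ (2 : ℝ) ≤ ∫⁻ z, g z ^ (2 : ℝ) ∂ν := by
  have h := ENNReal.lintegral_mul_le_Lp_mul_Lq ν Real.HolderConjugate.two_two hg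
    (aemeasurable_const (b := 1))
  simp only [Pi.mul_apply, mul_one, ENNReal.one_rpow, lintegral_const, hν] at h
  calc (∫⁻ z, g z ∂ν) ^ (2 : ℝ) ≤ ((∫⁻ z, g z ^ (2 : ℝ) ∂ν) ^ (1 / 2 : ℝ)) ^ (2 : ℝ) :=
        ENNReal.rpow_le_rpow h (by norm_num)
    _ = _ := by rw [← ENNReal.rpow_mul]; norm_num

theorem lintegral_comp_dilation {l : ℝ} (hl : 0 < l) (x₀ z : Space m) {g : Space m → ENNReal}
    (hg : Measurable g) :
    ∫⁻ x, g (l • (x - x₀) + x₀ - z) = ENNReal.ofReal (l ^ m)⁻¹ * ∫⁻ x, g x := by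
  have h1 : ∫⁻ x, g (l • (x - x₀) + x₀ - z) = ∫⁻ x, g (l • x + x₀ - z) :=
    lintegral_sub_right_eq_self (fun x => g (l • x + x₀ - z)) x₀
  have h2 : ∫⁻ x, g (l • x + x₀ - z) =
      ∫⁻ x, g (x + x₀ - z) ∂(Measure.map (l • ·) (volume : Measure (Space m))) := by
    rw [lintegral_map (by fun_prop) (by fun_prop)]
  have h3 : ∫⁻ x, g (x + x₀ - z) = ∫⁻ x, g x := by
    simp_rw [add_sub_assoc]
    exact lintegral_add_right_eq_self g (x₀ - z)
  rw [h1, h2, Measure.map_addHaar_smul _ hl.ne', lintegral_smul_measure, h3,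
    finrank_euclideanSpace, Fintype.card_fin, abs_of_pos (by positivity), smul_eq_mul]

/-- A dilation about `x₀` followed by a mollification with kernel `η`. -/
noncomputable def mollify (η : Space m → ℝ) (l : ℝ) (x₀ : Space m) (H : Space m → ℝ)
    (x : Space m) : ℝ :=
  ∫ z, η z * H (l • (x - x₀) + x₀ - z)

/-- The kernel is a probability density, so Cauchy–Schwarz moves the square inside the average;
Tonelli and the Jacobian of the dilation do the rest. -/
theorem lintegral_mollify_le {η : Space m → ℝ} (hη : Continuous η) (h0 : ∀ z, 0 ≤ η z)
    (h1 : ∫ z, η z = 1) {l : ℝ} (hl : 0 < l) (x₀ : Space m) {H : Space m → ℝ}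
    (hH : Measurable H) :
    ∫⁻ x, ‖mollify η l x₀ H x‖ₑ ^ (2 : ℝ) ≤
      ENNReal.ofReal (l ^ m)⁻¹ * ∫⁻ x, ‖H x‖ₑ ^ (2 : ℝ) := by
  have hint : Integrable η := .of_integral_ne_zero (by rw [h1]; exact one_ne_zero)
  set ν : Measure (Space m) := volume.withDensity fun z => ‖η z‖ₑ with hνdef
  have hηm : Measurable fun z => ‖η z‖ₑ := hη.measurable.enorm
  have hν : ν univ = 1 := by
    rw [hνdef, withDensity_apply _ MeasurableSet.univ, Measure.restrict_univ]
    have := ofReal_integral_eq_lintegral_ofReal hint (Eventually.of_forall h0)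
    rw [h1, ENNReal.ofReal_one] at this
    rw [this]
    exact lintegral_congr fun z => Real.enorm_of_nonneg (h0 z)
  have : IsProbabilityMeasure ν := ⟨hν⟩
  have hHe : Measurable fun x => ‖H x‖ₑ := hH.enorm
  have hpt : ∀ x, ‖mollify η l x₀ H x‖ₑ ^ (2 : ℝ) ≤
      ∫⁻ z, ‖H (l • (x - x₀) + x₀ - z)‖ₑ ^ (2 : ℝ) ∂ν := by
    intro x
    have hm : Measurable fun z => ‖H (l • (x - x₀) + x₀ - z)‖ₑ := hHe.comp (by fun_prop)
    refine le_trans (ENNReal.rpow_le_rpow ?_ (by norm_num)) (sq_lintegral_le hν hm.aemeasurable)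
    refine (enorm_integral_le_lintegral_enorm _).trans (le_of_eq ?_)
    rw [hνdef, lintegral_withDensity_eq_lintegral_mul _ hηm hm]
    exact lintegral_congr fun z => enorm_mul _ _
  calc ∫⁻ x, ‖mollify η l x₀ H x‖ₑ ^ (2 : ℝ)
      ≤ ∫⁻ x, ∫⁻ z, ‖H (l • (x - x₀) + x₀ - z)‖ₑ ^ (2 : ℝ) ∂ν := lintegral_mono hpt
    _ = ∫⁻ z, ∫⁻ x, ‖H (l • (x - x₀) + x₀ - z)‖ₑ ^ (2 : ℝ) ∂volume ∂ν := by
      refine lintegral_lintegral_swap (Measurable.aemeasurable ?_)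
      have : Measurable fun q : Space m × Space m => l • (q.1 - x₀) + x₀ - q.2 := by fun_prop
      exact (hHe.comp this).pow_const _
    _ = ENNReal.ofReal (l ^ m)⁻¹ * ∫⁻ x, ‖H x‖ₑ ^ (2 : ℝ) := by
      simp_rw [lintegral_comp_dilation hl x₀ _ (hHe.pow_const (2 : ℝ))]
      rw [lintegral_const, hν, mul_one]

theorem eLpNorm_mollify_le {η : Space m → ℝ} (hη : Continuous η) (h0 : ∀ z, 0 ≤ η z)
    (h1 : ∫ z, η z = 1) {l : ℝ} (hl : 1 / 2 ≤ l) (x₀ : Space m) {H : Space m → ℝ}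
    (hH : Measurable H) :
    eLpNorm (mollify η l x₀ H) 2 volume ≤ 2 ^ m * eLpNorm H 2 volume := by
  have hl0 : 0 < l := lt_of_lt_of_le (by norm_num) hl
  have h2 : ∀ g : Space m → ℝ, eLpNorm g 2 volume = (∫⁻ x, ‖g x‖ₑ ^ (2 : ℝ)) ^ (1 / 2 : ℝ) := by
    intro g
    rw [eLpNorm_eq_lintegral_rpow_enorm_toReal (by norm_num) (by norm_num)]
    simp
  rw [h2, h2]
  refine (ENNReal.rpow_le_rpow (lintegral_mollify_le hη h0 h1 hl0 x₀ hH) (by norm_num)).trans ?_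
  rw [ENNReal.mul_rpow_of_nonneg _ _ (by norm_num)]
  refine mul_le_mul_left ?_ _
  have h3 : ENNReal.ofReal (l ^ m)⁻¹ ≤ 2 ^ m := by
    rw [← inv_pow, ENNReal.ofReal_pow (by positivity)]
    gcongr
    rw [show (2 : ENNReal) = ENNReal.ofReal 2 by norm_num]
    refine ENNReal.ofReal_le_ofReal ?_
    rw [inv_le_comm₀ hl0 (by norm_num)]
    linarith
  refine (ENNReal.rpow_le_rpow h3 (by norm_num)).trans ?_
  calc ((2 : ENNReal) ^ m) ^ (1 / 2 : ℝ) ≤ ((2 : ENNReal) ^ m) ^ (1 : ℝ) :=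
        ENNReal.rpow_le_rpow_of_exponent_le (one_le_pow₀ (by norm_num)) (by norm_num)
    _ = 2 ^ m := ENNReal.rpow_one _

theorem integrable_mollify_integrand {η : Space m → ℝ} (hη : Continuous η)
    (hc : HasCompactSupport η) {H : Space m → ℝ} (hH : LocallyIntegrable H) (y : Space m) :
    Integrable fun z => η z * H (y - z) :=
  hc.convolutionExists_left (ContinuousLinearMap.mul ℝ ℝ) hη hH y

theorem mollify_sub {η : Space m → ℝ} (hη : Continuous η) (hc : HasCompactSupport η) (l : ℝ)
    (x₀ : Space m) {G H : Space m → ℝ} (hG : LocallyIntegrable G) (hH : LocallyIntegrable H)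
    (x : Space m) :
    mollify η l x₀ (fun x => G x - H x) x = mollify η l x₀ G x - mollify η l x₀ H x := by
  rw [mollify, mollify, mollify, ← integral_sub (integrable_mollify_integrand hη hc hG _)
    (integrable_mollify_integrand hη hc hH _)]
  simp_rw [mul_sub]

theorem contDiff_mollify {η : Space m → ℝ} (hη : ContDiff ℝ ∞ η) (hc : HasCompactSupport η)
    (l : ℝ) (x₀ : Space m) {H : Space m → ℝ} (hH : LocallyIntegrable H) :
    ContDiff ℝ ∞ (mollify η l x₀ H) := by
  have h := hc.contDiff_convolution_left (ContinuousLinearMap.mul ℝ ℝ) (n := ⊤) hη hH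
  exact h.comp (by fun_prop : ContDiff ℝ ∞ fun x : Space m => l • (x - x₀) + x₀)

/-- Mollification with small kernels and dilation factors close to `1` is close to the identity on
uniformly continuous functions. -/
theorem abs_mollify_sub_le {η : Space m → ℝ} (hη : Continuous η) (h0 : ∀ z, 0 ≤ η z)
    (h1 : ∫ z, η z = 1) (hc : HasCompactSupport η) {l : ℝ} {x₀ x : Space m} {H : Space m → ℝ}
    (hH : Continuous H) {e : ℝ}
    (he : ∀ z, η z ≠ 0 → |H (l • (x - x₀) + x₀ - z) - H x| ≤ e) :
    |mollify η l x₀ H x - H x| ≤ e := by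
  have hint : Integrable η := .of_integral_ne_zero (by rw [h1]; exact one_ne_zero)
  have h2 : mollify η l x₀ H x - H x =
      ∫ z, η z * (H (l • (x - x₀) + x₀ - z) - H x) := by
    simp_rw [mul_sub]
    rw [integral_sub (integrable_mollify_integrand hη hc hH.locallyIntegrable _)
      (hint.mul_const _), integral_mul_const, h1, one_mul, mollify]
  rw [h2, ← Real.norm_eq_abs]
  refine (norm_integral_le_of_norm_le (hint.mul_const e) (Eventually.of_forall fun z => ?_)).trans
    (le_of_eq (by rw [integral_mul_const, h1, one_mul]))
  rw [norm_mul, Real.norm_of_nonneg (h0 z)]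
  by_cases hz : η z = 0
  · simp [hz]
  · exact mul_le_mul_of_nonneg_left (he z hz) (h0 z)

/-- The operators are bounded on `L²` uniformly in `k`, so it suffices to treat a continuous
compactly supported approximation `H` of `F`. Its uniform continuity applies because dilation and
kernel move points of `K` by at most `|l k - 1| * R + δ k`. -/
theorem tendsto_eLpNorm_mollify_sub {η : ℕ → Space m → ℝ} (hη : ∀ k, Continuous (η k))
    (h0 : ∀ k z, 0 ≤ η k z) (h1 : ∀ k, ∫ z, η k z = 1) (hc : ∀ k, HasCompactSupport (η k))
    {δ : ℕ → ℝ} (hδ : Tendsto δ atTop (𝓝 0)) (hηδ : ∀ k z, η k z ≠ 0 → ‖z‖ ≤ δ k)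
    {l : ℕ → ℝ} (hl : Tendsto l atTop (𝓝 1)) (hl2 : ∀ k, 1 / 2 ≤ l k) (x₀ : Space m)
    {K : Set (Space m)} (hK : IsCompact K) {F : Space m → ℝ} (hF : MemLp F 2 volume)
    (hFm : Measurable F) :
    Tendsto (fun k => eLpNorm (fun x => mollify (η k) (l k) x₀ F x - F x) 2 (vol K))
      atTop (𝓝 0) := by
  have hFloc : LocallyIntegrable F := hF.locallyIntegrable (by norm_num)
  obtain ⟨R, hR0, hR⟩ := hK.isBounded.subset_closedBall_lt 0 x₀
  have hKfin : vol K univ ≠ ⊤ := by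
    rw [Measure.restrict_apply_univ]; exact hK.measure_lt_top.ne
  rw [ENNReal.tendsto_nhds_zero]
  intro e he
  rcases eq_or_ne e ⊤ with rfl | hetop
  · exact Eventually.of_forall fun _ => le_top
  -- The approximation error `F - H` occurs once mollified, costing the factor `2 ^ m`, and once
  -- directly; the uniform error for `H` takes the other half of `e`.
  set C : ENNReal := 2 ^ m + 1 with hC
  have hCtop : C ≠ ⊤ := by finiteness
  have hC0 : C ≠ 0 := by positivity
  have he2 : e / 2 ≠ 0 := by simpa using he.ne'
  obtain ⟨H, hHc, hHe, hHcont, hHmem⟩ :=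
    hF.exists_hasCompactSupport_eLpNorm_sub_le (by norm_num) (ENNReal.div_ne_zero.2 ⟨he2, hCtop⟩)
  obtain ⟨s, hs0, hs⟩ : ∃ s : ℝ, 0 < s ∧
      ENNReal.ofReal s * vol K univ ^ (1 / 2 : ℝ) ≤ e / 2 := by
    set A := vol K univ ^ (1 / 2 : ℝ) with hA
    have hAtop : A ≠ ⊤ := ENNReal.rpow_ne_top_of_nonneg (by norm_num) hKfin
    have hpos : 0 < e / 2 / (A + 1) := ENNReal.div_pos he2 (by finiteness)
    have hfin : e / 2 / (A + 1) ≠ ⊤ :=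
      ENNReal.div_ne_top (ENNReal.div_ne_top hetop (by norm_num)) (by simp)
    refine ⟨(e / 2 / (A + 1)).toReal, ENNReal.toReal_pos hpos.ne' hfin, ?_⟩
    rw [ENNReal.ofReal_toReal hfin]
    calc e / 2 / (A + 1) * A ≤ e / 2 / (A + 1) * (A + 1) := by gcongr; exact le_self_add
      _ ≤ e / 2 := (ENNReal.div_mul_cancel (by simp) (by finiteness)).le
  obtain ⟨d, hd0, hd⟩ := Metric.uniformContinuous_iff.1
    (hHc.uniformContinuous_of_continuous hHcont) s hs0
  have hlim : Tendsto (fun k => |l k - 1| * R + δ k) atTop (𝓝 0) := by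
    have h2 : Tendsto (fun k => |l k - 1|) atTop (𝓝 0) := by
      have := (hl.sub_const 1).abs
      simpa using this
    simpa using (h2.mul_const R).add hδ
  filter_upwards [hlim.eventually (gt_mem_nhds hd0)] with k hk
  have hFH : eLpNorm (fun x => F x - H x) 2 volume ≤ e / 2 / C := hHe
  have hmol : eLpNorm (fun x => mollify (η k) (l k) x₀ (fun x => F x - H x) x) 2 (vol K) ≤
      2 ^ m * (e / 2 / C) :=
    (eLpNorm_mono_measure _ Measure.restrict_le_self).trans
      ((eLpNorm_mollify_le (hη k) (h0 k) (h1 k) (hl2 k) x₀ (hFm.sub hHcont.measurable)).trans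
        (by gcongr))
  have hunif : eLpNorm (fun x => mollify (η k) (l k) x₀ H x - H x) 2 (vol K) ≤ e / 2 := by
    refine (eLpNorm_le_of_ae_bound (C := s) ?_).trans ?_
    · filter_upwards [ae_restrict_mem hK.isClosed.measurableSet] with x hx
      refine abs_mollify_sub_le (hη k) (h0 k) (h1 k) (hc k) hHcont fun z hz => ?_
      rw [← Real.dist_eq]
      refine (hd ?_).le
      rw [dist_eq_norm, show l k • (x - x₀) + x₀ - z - x = (l k - 1) • (x - x₀) - z by
        rw [sub_smul, one_smul]; abel]
      refine (norm_sub_le _ _).trans_lt (lt_of_le_of_lt (add_le_add ?_ (hηδ k z hz)) hk)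
      rw [norm_smul, Real.norm_eq_abs]
      refine mul_le_mul_of_nonneg_left ?_ (abs_nonneg _)
      rw [← dist_eq_norm]
      exact hR hx
    · rw [mul_comm]
      simpa using hs
  have hmc : ∀ {G : Space m → ℝ}, LocallyIntegrable G → AEStronglyMeasurable
      (mollify (η k) (l k) x₀ G) (vol K) := by
    intro G hG
    have : Continuous (convolution (η k) G (ContinuousLinearMap.mul ℝ ℝ) volume) :=
      (hc k).continuous_convolution_left _ (hη k) hG
    exact (this.comp (by fun_prop : Continuous fun x : Space m =>
      l k • (x - x₀) + x₀)).aestronglyMeasurable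
  have hHloc : LocallyIntegrable H := hHcont.locallyIntegrable
  have hdecomp : (fun x => mollify (η k) (l k) x₀ F x - F x) =
      ((fun x => mollify (η k) (l k) x₀ (fun x => F x - H x) x) +
        fun x => mollify (η k) (l k) x₀ H x - H x) - fun x => F x - H x := by
    ext x
    simp only [Pi.add_apply, Pi.sub_apply]
    rw [mollify_sub (hη k) (hc k) _ _ hFloc hHloc]
    ring
  have hsm : AEStronglyMeasurable (fun x => F x - H x) (vol K) :=
    (hFm.sub hHcont.measurable).aestronglyMeasurable
  have hsum : AEStronglyMeasurable (fun x => mollify (η k) (l k) x₀ H x - H x) (vol K) :=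
    (hmc hHloc).sub hHcont.aestronglyMeasurable
  rw [hdecomp]
  calc _ ≤ _ := eLpNorm_sub_le ((hmc (hFloc.sub hHloc)).add hsum) hsm (by norm_num)
    _ ≤ (2 ^ m * (e / 2 / C) + e / 2) + e / 2 / C :=
      add_le_add ((eLpNorm_add_le (hmc (hFloc.sub hHloc)) hsum (by norm_num)).trans
        (add_le_add hmol hunif)) ((eLpNorm_mono_measure _ Measure.restrict_le_self).trans hFH)
    _ = C * (e / 2 / C) + e / 2 := by rw [hC]; ring
    _ = e / 2 + e / 2 := by rw [ENNReal.mul_div_cancel hC0 hCtop]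
    _ = e := ENNReal.add_halves e

end Mollification

/-! ### Density of smooth functions in `H¹` of a convex body -/

section Density

variable {m : ℕ}

theorem hasWeakPartial_weakPartial {K : Set (Space m)} {f : Lp ℝ 2 (vol K)} (hf : MemH1 K f)
    (μ : Fin m) : HasWeakPartial K μ f (weakPartial K μ f) := by
  rw [weakPartial, dif_pos (hf μ)]
  exact (hf μ).choose_spec

/-- A point within `δ` of the dilated `x` is the combination, with weights `1 - l` and `l`, of a
point in the open ball about `x₀` and of `x`. Combining an interior point with a point of a convex
set gives an interior point. -/
theorem closedBall_dilation_subset {K : Set (Space m)} (hK : Convex ℝ K) {x₀ x : Space m}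
    {ρ l δ : ℝ} (hball : Metric.closedBall x₀ ρ ⊆ K) (hx : x ∈ K) (hl0 : 0 ≤ l) (hl1 : l < 1)
    (hδ : δ < (1 - l) * ρ) : Metric.closedBall (l • (x - x₀) + x₀) δ ⊆ interior K := by
  intro w hw
  rw [Metric.mem_closedBall, dist_eq_norm] at hw
  have h1 : 0 < 1 - l := sub_pos.2 hl1
  refine hK.combo_interior_self_subset_interior h1 hl0 (by ring)
    (Set.mem_add.2 ⟨(1 - l) • (x₀ + (1 - l)⁻¹ • (w - (l • (x - x₀) + x₀))),
      smul_mem_smul_set ?_, l • x, smul_mem_smul_set hx, ?_⟩)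
  · refine interior_mono hball (Metric.ball_subset_interior_closedBall ?_)
    rw [Metric.mem_ball, dist_eq_norm, add_sub_cancel_left, norm_smul, norm_inv,
      Real.norm_of_nonneg h1.le, inv_mul_lt_iff₀ h1]
    exact hw.trans_lt hδ
  · rw [smul_add, smul_smul, mul_inv_cancel₀ h1.ne', one_smul, smul_sub, sub_smul, one_smul]
    abel

/-- The derivative falls on the kernel and is then moved to `f` by the definition of the weak
derivative. Shrinking towards `x₀` first keeps the translated kernel inside the interior, even for
`x` on the boundary; the chain rule contributes the factor `l`. -/
theorem fderiv_mollify {K : Set (Space m)} (hK : IsCompact K) (hconv : Convex ℝ K)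
    {x₀ x : Space m} {ρ l δ : ℝ} (hball : Metric.closedBall x₀ ρ ⊆ K) (hx : x ∈ K) (hl0 : 0 ≤ l)
    (hl1 : l < 1) (hδ : δ < (1 - l) * ρ) {η : Space m → ℝ} (hη : ContDiff ℝ ∞ η)
    (hc : HasCompactSupport η) (hηδ : ∀ z, η z ≠ 0 → ‖z‖ ≤ δ) {μ : Fin m}
    {f g : Lp ℝ 2 (vol K)} (hfg : HasWeakPartial K μ f g)
    (hf : LocallyIntegrable (K.indicator f)) :
    fderiv ℝ (mollify η l x₀ (K.indicator f)) x (EuclideanSpace.single μ 1) =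
      l * mollify η l x₀ (K.indicator g) x := by
  set e : Space m := EuclideanSpace.single μ 1
  set y : Space m := l • (x - x₀) + x₀ with hy
  set L := ContinuousLinearMap.mul ℝ ℝ
  have hη1 : ContDiff ℝ 1 η := hη.of_le (by simp)
  have hconvd := hc.hasFDerivAt_convolution_left L hη1 hf y
  have hA : HasFDerivAt (fun x : Space m => l • (x - x₀) + x₀)
      (l • ContinuousLinearMap.id ℝ (Space m)) x :=
    (((hasFDerivAt_id x).sub_const x₀).const_smul l).add_const x₀
  have hcomp : HasFDerivAt (mollify η l x₀ (K.indicator f))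
      ((convolution (fderiv ℝ η) (K.indicator f) (L.precompL (Space m)) volume y).comp
        (l • ContinuousLinearMap.id ℝ (Space m))) x :=
    HasFDerivAt.comp (g := convolution η (K.indicator f) L volume) x hconvd hA
  have hex := (hc.fderiv ℝ).convolutionExists_left (L.precompL (Space m))
    (hη1.continuous_fderiv (by simp)) hf y
  have h1 : (convolution (fderiv ℝ η) (K.indicator f) (L.precompL (Space m)) volume y) e =
      ∫ w in K, fderiv ℝ η (y - w) e * f w := by
    rw [convolution_def, ContinuousLinearMap.integral_apply hex, ← integral_indicator
      hK.isClosed.measurableSet, ← integral_sub_left_eq_self _ volume y]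
    refine integral_congr_ae (Eventually.of_forall fun w => ?_)
    simp only [sub_sub_cancel]
    by_cases hw : w ∈ K <;> simp [L, hw]
  have hsub : tsupport (fun w => η (y - w)) ⊆ interior K := by
    refine Subset.trans (closure_minimal ?_ Metric.isClosed_closedBall)
      (closedBall_dilation_subset hconv hball hx hl0 hl1 hδ)
    intro w hw
    rw [Metric.mem_closedBall, dist_eq_norm, norm_sub_rev]
    exact hηδ _ hw
  have hcs : HasCompactSupport fun w => η (y - w) :=
    hK.of_isClosed_subset (isClosed_tsupport _) (hsub.trans interior_subset)
  have hder : ∀ w, fderiv ℝ (fun w => η (y - w)) w e = -fderiv ℝ η (y - w) e := by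
    intro w
    have := ((hη1.differentiable (by simp) (y - w)).hasFDerivAt.comp w
      ((hasFDerivAt_id w).const_sub y)).fderiv
    have h2 : fderiv ℝ (fun w => η (y - w)) w = _ := this
    rw [h2]
    simp
  have h2 := hfg (fun w => η (y - w)) (hη.comp (by fun_prop)) hcs hsub
  have h3 : mollify η l x₀ (K.indicator g) x = ∫ w in K, g w * η (y - w) := by
    rw [mollify, ← integral_indicator hK.isClosed.measurableSet,
      ← integral_sub_left_eq_self _ volume y]
    refine integral_congr_ae (Eventually.of_forall fun w => ?_)
    simp only [← hy, sub_sub_cancel]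
    by_cases hw : w ∈ K <;> simp [hw, mul_comm]
  rw [hcomp.fderiv, ContinuousLinearMap.comp_apply, smul_apply,
    ContinuousLinearMap.id_apply, map_smul, h1, smul_eq_mul, h3]
  congr 1
  have h4 : ∫ w in K, f w * fderiv ℝ (fun w => η (y - w)) w e =
      -∫ w in K, fderiv ℝ η (y - w) e * f w := by
    rw [← integral_neg]
    simp_rw [hder]
    refine integral_congr_ae (Eventually.of_forall fun w => ?_)
    simp only
    ring
  rw [h4] at h2
  exact neg_injective h2

theorem memLp_indicator {K : Set (Space m)} (hK : MeasurableSet K) (f : Lp ℝ 2 (vol K)) :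
    MemLp (K.indicator f) 2 volume :=
  (memLp_indicator_iff_restrict hK).2 (Lp.memLp f)

/-- Smooth functions are dense in `H¹` of a convex body. -/
theorem exists_smooth_approx {K : Set (Space m)} (hK : IsCompact K) (hconv : Convex ℝ K)
    {x₀ : Space m} {ρ : ℝ} (hρ : 0 < ρ) (hball : Metric.closedBall x₀ ρ ⊆ K)
    {f : Lp ℝ 2 (vol K)} (hf : MemH1 K f) :
    ∃ φ : ℕ → Space m → ℝ, (∀ k, ContDiff ℝ ∞ (φ k)) ∧
      Tendsto (fun k => eLpNorm (fun x => φ k x - f x) 2 (vol K)) atTop (𝓝 0) ∧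
      ∀ μ : Fin m, Tendsto (fun k => eLpNorm (fun x =>
        fderiv ℝ (φ k) x (EuclideanSpace.single μ 1) - weakPartial K μ f x) 2 (vol K))
        atTop (𝓝 0) := by
  have hKm := hK.isClosed.measurableSet
  have hlim : Tendsto (fun k : ℕ => 1 / ((k : ℝ) + 2)) atTop (𝓝 0) :=
    (tendsto_const_nhds (x := (1 : ℝ))).div_atTop
      (tendsto_atTop_add_const_right _ _ tendsto_natCast_atTop_atTop)
  have hpos : ∀ k : ℕ, 0 < 1 / ((k : ℝ) + 2) := fun k => by positivity
  have hhalf : ∀ k : ℕ, 1 / ((k : ℝ) + 2) ≤ 1 / 2 := fun k =>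
    one_div_le_one_div_of_le (by norm_num) (by linarith [k.cast_nonneg (α := ℝ)])
  -- With `1 - l = 1 / (k + 2)`, the radius `δ` is half of `(1 - l) * ρ`, within the room that the
  -- dilation leaves, and the offset 2 ensures `l ≥ 1 / 2`.
  let δ : ℕ → ℝ := fun k => 1 / ((k : ℝ) + 2) * (ρ / 2)
  have hδpos : ∀ k, 0 < δ k := fun k => mul_pos (hpos k) (half_pos hρ)
  let l : ℕ → ℝ := fun k => 1 - 1 / ((k : ℝ) + 2)
  let η : ℕ → Space m → ℝ := fun k =>
    (⟨δ k / 2, δ k, half_pos (hδpos k), half_lt_self (hδpos k)⟩ :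
      ContDiffBump (0 : Space m)).normed volume
  have hη : ∀ k, ContDiff ℝ ∞ (η k) := fun k => ContDiffBump.contDiff_normed _
  have h0 : ∀ k z, 0 ≤ η k z := fun k z => ContDiffBump.nonneg_normed _ z
  have h1 : ∀ k, ∫ z, η k z = 1 := fun k => ContDiffBump.integral_normed _
  have hc : ∀ k, HasCompactSupport (η k) := fun k => ContDiffBump.hasCompactSupport_normed _
  have hηδ : ∀ k z, η k z ≠ 0 → ‖z‖ ≤ δ k := by
    intro k z hz
    have : z ∈ Function.support (η k) := hz
    rw [ContDiffBump.support_normed_eq, mem_ball_zero_iff] at this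
    exact this.le
  have hδlim : Tendsto δ atTop (𝓝 0) := by simpa [δ] using hlim.mul_const (ρ / 2)
  have hl : Tendsto l atTop (𝓝 1) := by simpa [l] using hlim.const_sub 1
  have hl2 : ∀ k, 1 / 2 ≤ l k := fun k => by
    have := hhalf k
    simp only [l]
    linarith
  have hl1 : ∀ k, l k < 1 := fun k => sub_lt_self _ (hpos k)
  have hδl : ∀ k, δ k < (1 - l k) * ρ := fun k => by
    simp only [l, δ, sub_sub_cancel]
    exact mul_lt_mul_of_pos_left (half_lt_self hρ) (hpos k)
  have hloc : ∀ g : Lp ℝ 2 (vol K), LocallyIntegrable (K.indicator g) := fun g =>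
    (memLp_indicator hKm g).locallyIntegrable (by norm_num)
  have hconvg : ∀ g : Lp ℝ 2 (vol K), Tendsto (fun k => eLpNorm (fun x =>
      mollify (η k) (l k) x₀ (K.indicator g) x - g x) 2 (vol K)) atTop (𝓝 0) := by
    intro g
    refine (tendsto_eLpNorm_mollify_sub (fun k => (hη k).continuous) h0 h1 hc hδlim hηδ hl hl2 x₀ hK
      (memLp_indicator hKm g) ((Lp.stronglyMeasurable g).measurable.indicator hKm)).congr
      fun k => eLpNorm_congr_ae ?_
    filter_upwards [ae_restrict_mem hKm] with x hx
    rw [indicator_of_mem hx]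
  refine ⟨fun k => mollify (η k) (l k) x₀ (K.indicator f),
    fun k => contDiff_mollify (hη k) (hc k) _ _ (hloc f), hconvg f, fun μ => ?_⟩
  set g := weakPartial K μ f with hg
  have hmm : ∀ k, AEStronglyMeasurable (mollify (η k) (l k) x₀ (K.indicator g)) (vol K) :=
    fun k => (contDiff_mollify (hη k) (hc k) _ _ (hloc g)).continuous.aestronglyMeasurable
  have hbound : ∀ k, eLpNorm (fun x => fderiv ℝ (mollify (η k) (l k) x₀ (K.indicator f)) x
      (EuclideanSpace.single μ 1) - g x) 2 (vol K) ≤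
      eLpNorm (fun x => mollify (η k) (l k) x₀ (K.indicator g) x - g x) 2 (vol K) +
        ENNReal.ofReal (1 - l k) * eLpNorm g 2 (vol K) := by
    intro k
    -- The derivative is `l` times the mollified `g`, so the error is `l` times the mollification
    -- error of `g` minus `(1 - l) • g`.
    have he : (fun x => fderiv ℝ (mollify (η k) (l k) x₀ (K.indicator f)) x
        (EuclideanSpace.single μ 1) - g x) =ᵐ[vol K]
        (l k • fun x => mollify (η k) (l k) x₀ (K.indicator g) x - g x) - (1 - l k) • g := by
      filter_upwards [ae_restrict_mem hKm] with x hx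
      rw [fderiv_mollify hK hconv hball hx (by linarith [hl2 k]) (hl1 k) (hδl k) (hη k) (hc k)
        (hηδ k) (hasWeakPartial_weakPartial hf μ) (hloc f)]
      simp only [Pi.sub_apply, Pi.smul_apply, smul_eq_mul, ← hg]
      ring
    have hg2 := (Lp.memLp g).1
    rw [eLpNorm_congr_ae he]
    refine (eLpNorm_sub_le (((hmm k).sub hg2).const_smul _) (hg2.const_smul _)
      (by norm_num)).trans (add_le_add ?_ ?_)
    · rw [eLpNorm_const_smul]
      refine mul_le_of_le_one_left zero_le ?_
      rw [Real.enorm_of_nonneg (by linarith [hl2 k]), ENNReal.ofReal_le_one]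
      exact (hl1 k).le
    · rw [eLpNorm_const_smul, Real.enorm_of_nonneg (by linarith [hl1 k])]
  have hz : Tendsto (fun k => ENNReal.ofReal (1 - l k) * eLpNorm g 2 (vol K)) atTop (𝓝 0) := by
    have h2 : Tendsto (fun k => ENNReal.ofReal (1 - l k)) atTop (𝓝 0) := by
      have := ENNReal.tendsto_ofReal (hl.const_sub 1)
      simpa using this
    simpa using ENNReal.Tendsto.mul_const h2 (Or.inr (Lp.memLp g).eLpNorm_ne_top)
  have hsum := (hconvg g).add hz
  rw [add_zero] at hsum
  exact tendsto_of_tendsto_of_tendsto_of_le_of_le tendsto_const_nhds hsum (fun _ => zero_le) hbound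

end Density

/-! ### Existence of traces -/

section Simplex

variable {m : ℕ} {ι : Type*} [Fintype ι] (b : AffineBasis ι ℝ (Space m))

theorem isTrace_trace (hm : 0 < m) {K : Set (Space m)} (hK : K = convexHull ℝ (range b))
    {f : Lp ℝ 2 (vol K)} (hf : MemH1 K f) : IsTrace K f (trace K f) := by
  obtain ⟨x₀, ρ, hρ, hball⟩ := exists_closedBall_subset b
  rw [← hK] at hball
  obtain ⟨φ, hφ, h0, h1⟩ := exists_smooth_approx (hK ▸ isCompact_convexHull_range b)
    (hK ▸ convex_convexHull ℝ _) hρ hball hf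
  have h := exists_isTrace_of_approx b hm hK f φ hφ h0 h1
  rw [trace, dif_pos h]
  exact h.choose_spec

end Simplex

/-! ### The density as a continuous bilinear map into `L¹` -/

section Pairing

variable {m n : ℕ} {K : Set (Space m)}

/-- The pointwise inner product, as a bilinear map `L² × L² → L¹`. -/
noncomputable def pairing (K : Set (Space m)) :
    Lp (Fld n) 2 (vol K) →L[ℝ] Lp (Fld n) 2 (vol K) →L[ℝ] Lp ℝ 1 (vol K) :=
  (innerSL ℝ : Fld n →L[ℝ] Fld n →L[ℝ] ℝ).holderL (vol K) 2 2 1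

theorem coeFn_pairing (f g : Lp (Fld n) 2 (vol K)) :
    pairing K f g =ᵐ[vol K] fun x => inner ℝ (f x) (g x) :=
  (innerSL ℝ : Fld n →L[ℝ] Fld n →L[ℝ] ℝ).coeFn_holder f g

theorem omegaZero_eq (v r v' r' : Lp (Fld n) 2 (vol K)) :
    omegaZero v r v' r' = pairing K v r' - pairing K v' r := by
  apply Lp.ext
  refine (Integrable.coeFn_toL1 _).trans ?_
  filter_upwards [Lp.coeFn_sub (pairing K v r') (pairing K v' r), coeFn_pairing v r',
    coeFn_pairing v' r] with x h1 h2 h3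
  rw [h1, Pi.sub_apply, Pi.sub_apply, h2, h3]

theorem integralCLM_pairing (f g : Lp (Fld n) 2 (vol K)) :
    L1.integralCLM (pairing K f g) = ∫ x in K, ∑ i, f x i * g x i := by
  rw [← L1.integral_eq, L1.integral_eq_integral]
  refine integral_congr_ae ?_
  filter_upwards [coeFn_pairing f g] with x hx
  rw [hx, PiLp.inner_apply]
  refine Finset.sum_congr rfl fun i _ => ?_
  rw [RCLike.inner_apply, conj_trivial, mul_comm]

theorem integral_eq_integralCLM (f : Lp ℝ 1 (vol K)) : ∫ x in K, f x = L1.integralCLM f := by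
  rw [← L1.integral_eq, L1.integral_eq_integral]

end Pairing

/-! ### Boundary integrals and integration by parts for vector fields -/

section Boundary

variable {m n : ℕ}

/-- The hypothesis that every component of a function is square integrable. -/
def ComponentsL2 {α ι : Type*} {mα : MeasurableSpace α} (ν : Measure α)
    (f : α → EuclideanSpace ℝ ι) : Prop :=
  ∀ i, MemLp (fun x => f x i) 2 ν

theorem MemLp.componentsL2 {α ι : Type*} [Fintype ι] {mα : MeasurableSpace α} {ν : Measure α}
    {f : α → EuclideanSpace ℝ ι} (hf : MemLp f 2 ν) : ComponentsL2 ν f :=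
  fun i => (EuclideanSpace.proj i : EuclideanSpace ℝ ι →L[ℝ] ℝ).comp_memLp' hf

theorem ComponentsL2.sub {α ι : Type*} {mα : MeasurableSpace α} {ν : Measure α}
    {f g : α → EuclideanSpace ℝ ι} (hf : ComponentsL2 ν f) (hg : ComponentsL2 ν g) :
    ComponentsL2 ν fun x => f x - g x :=
  fun i => (hf i).sub (hg i)

/-- `traceVec` is assembled pointwise from scalar traces and is not an element of `Lp`, hence the
componentwise notion of square integrability. -/
theorem componentsL2_traceVec {ι : Type} [Fintype ι] {K : Set (Space m)}
    (f : Lp (EuclideanSpace ℝ ι) 2 (vol K)) :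
    ComponentsL2 (surf (frontier K)) (traceVec f) :=
  fun i => Lp.memLp (trace K (comp i f))

variable {ι : Type*} [Fintype ι] (b : AffineBasis ι ℝ (Space m))

theorem integrable_mul_outerNormal_apply {K : Set (Space m)} (hK : K = convexHull ℝ (range b))
    {f g : Space m → ℝ} (hf : MemLp f 2 (surf (frontier K)))
    (hg : MemLp g 2 (surf (frontier K))) (μ : Fin m) :
    Integrable (fun x => f x * g x * outerNormal K x μ) (surf (frontier K)) := by
  have h := memLp_mul_outerNormal b μ.pos (hK ▸ hg) (EuclideanSpace.single μ 1)
  rw [← hK] at h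
  refine (hf.integrable_mul h).congr (Eventually.of_forall fun x => ?_)
  simp only [Pi.mul_apply]
  rw [EuclideanSpace.inner_single_right, one_mul, conj_trivial, mul_assoc]

theorem integrable_bdryInt {K : Set (Space m)} (hK : K = convexHull ℝ (range b))
    {p : Space m → Fld n} {q : Space m → Flx m n} (hp : ComponentsL2 (surf (frontier K)) p)
    (hq : ComponentsL2 (surf (frontier K)) q) :
    Integrable (fun x => ∑ i, ∑ μ, p x i * q x (μ, i) * outerNormal K x μ)
      (surf (frontier K)) :=
  integrable_finsetSum _ fun i _ => integrable_finsetSum _ fun μ _ =>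
    integrable_mul_outerNormal_apply b hK (hp i) (hq (μ, i)) μ

theorem bdryWedge_eq {K : Set (Space m)} (hK : K = convexHull ℝ (range b))
    {p p' : Space m → Fld n} {q q' : Space m → Flx m n}
    (hp : ComponentsL2 (surf (frontier K)) p) (hq : ComponentsL2 (surf (frontier K)) q)
    (hp' : ComponentsL2 (surf (frontier K)) p') (hq' : ComponentsL2 (surf (frontier K)) q') :
    bdryWedge K p q p' q' = bdryInt K p q' - bdryInt K p' q := by
  rw [bdryInt, bdryInt, ← integral_sub (integrable_bdryInt b hK hp hq')
    (integrable_bdryInt b hK hp' hq), bdryWedge]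
  refine integral_congr_ae (Eventually.of_forall fun x => ?_)
  simp only [sub_mul, Finset.sum_sub_distrib]

theorem bdryInt_sub_sub {K : Set (Space m)} (hK : K = convexHull ℝ (range b))
    {p p' : Space m → Fld n} {q q' : Space m → Flx m n}
    (hp : ComponentsL2 (surf (frontier K)) p) (hq : ComponentsL2 (surf (frontier K)) q)
    (hp' : ComponentsL2 (surf (frontier K)) p') (hq' : ComponentsL2 (surf (frontier K)) q') :
    bdryInt K (fun x => p x - p' x) (fun x => q x - q' x) =
      bdryInt K p q - bdryInt K p q' - bdryInt K p' q + bdryInt K p' q' := by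
  have i1 := integrable_bdryInt b hK hp hq
  have i2 := integrable_bdryInt b hK hp hq'
  have i3 := integrable_bdryInt b hK hp' hq
  have i4 := integrable_bdryInt b hK hp' hq'
  simp only [bdryInt]
  rw [← integral_sub' i1 i2, ← integral_sub' (i1.sub i2) i3, ← integral_add' ((i1.sub i2).sub i3) i4]
  refine integral_congr_ae (Eventually.of_forall fun x => ?_)
  simp only [Pi.add_apply, Pi.sub_apply, ← Finset.sum_sub_distrib, ← Finset.sum_add_distrib, PiLp.sub_apply]
  refine Finset.sum_congr rfl fun i _ => Finset.sum_congr rfl fun μ _ => ?_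
  ring

theorem ae_comp {κ : Type} [Fintype κ] {K : Set (Space m)}
    (f : Lp (EuclideanSpace ℝ κ) 2 (vol K)) (i : κ) :
    ∀ᵐ x ∂vol K, comp i f x = f x i :=
  (EuclideanSpace.proj i : EuclideanSpace ℝ κ →L[ℝ] ℝ).coeFn_compLp f

theorem integrable_mul_weakPartial {κ : Type} [Fintype κ] {K : Set (Space m)}
    (f : Lp (EuclideanSpace ℝ κ) 2 (vol K)) (i : κ) (g : Lp ℝ 2 (vol K)) :
    Integrable (fun x => f x i * g x) (vol K) :=
  (MemLp.componentsL2 (Lp.memLp f) i).integrable_mul (Lp.memLp g)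

/-- Integration by parts on a simplex, for vector fields. -/
theorem integral_traceVec {K : Set (Space m)} (hK : K = convexHull ℝ (range b))
    {v : Lp (Fld n) 2 (vol K)} {τ : Lp (Flx m n) 2 (vol K)} (hv : ∀ i, MemH1 K (comp i v))
    (hτ : ∀ j, MemH1 K (comp j τ)) :
    (∫ x in K, ∑ i, ∑ μ, v x i * weakPartial K μ (comp (μ, i) τ) x) +
        ∫ x in K, ∑ i, ∑ μ, τ x (μ, i) * weakPartial K μ (comp i v) x =
      bdryInt K (traceVec v) (traceVec τ) := by
  have h : ∀ (i : Fin n) (μ : Fin m),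
      (∫ x in K, v x i * weakPartial K μ (comp (μ, i) τ) x) +
        ∫ x in K, τ x (μ, i) * weakPartial K μ (comp i v) x =
      ∫ x, traceVec v x i * traceVec τ x (μ, i) * outerNormal K x μ ∂surf (frontier K) := by
    intro i μ
    -- An index `μ` exists only if `0 < m`; for `m = 0` all sums over `μ` are empty, so no dimension
    -- hypothesis is needed.
    have h1 := setIntegral_mul_weakPartial_add b μ.pos hK (isTrace_trace b μ.pos hK (hv i))
      (isTrace_trace b μ.pos hK (hτ (μ, i))) μ
    have e1 : ∫ x in K, comp i v x * weakPartial K μ (comp (μ, i) τ) x =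
        ∫ x in K, v x i * weakPartial K μ (comp (μ, i) τ) x := by
      refine integral_congr_ae ?_
      filter_upwards [ae_comp v i] with x hx
      rw [hx]
    have e2 : ∫ x in K, weakPartial K μ (comp i v) x * comp (μ, i) τ x =
        ∫ x in K, τ x (μ, i) * weakPartial K μ (comp i v) x := by
      refine integral_congr_ae ?_
      filter_upwards [ae_comp τ (μ, i)] with x hx
      rw [hx, mul_comm]
    rw [e1, e2] at h1
    rw [h1]
    refine integral_congr_ae (Eventually.of_forall fun x => ?_)
    simp only [traceVec, mul_assoc]
  have hI1 : ∀ i μ, Integrable (fun x => v x i * weakPartial K μ (comp (μ, i) τ) x) (vol K) :=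
    fun i μ => integrable_mul_weakPartial v i _
  have hI2 : ∀ i μ, Integrable (fun x => τ x (μ, i) * weakPartial K μ (comp i v) x) (vol K) :=
    fun i μ => integrable_mul_weakPartial τ (μ, i) _
  have hI3 := fun (i : Fin n) (μ : Fin m) => integrable_mul_outerNormal_apply b hK
    (componentsL2_traceVec v i) (componentsL2_traceVec τ (μ, i)) μ
  rw [bdryInt, integral_finsetSum _ fun i _ => integrable_finsetSum _ fun μ _ => hI1 i μ,
    integral_finsetSum _ fun i _ => integrable_finsetSum _ fun μ _ => hI2 i μ,
    integral_finsetSum _ fun i _ => integrable_finsetSum _ fun μ _ => hI3 i μ,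
    ← Finset.sum_add_distrib]
  refine Finset.sum_congr rfl fun i _ => ?_
  rw [integral_finsetSum _ fun μ _ => hI1 i μ, integral_finsetSum _ fun μ _ => hI2 i μ,
    integral_finsetSum _ fun μ _ => hI3 i μ, ← Finset.sum_add_distrib]
  exact Finset.sum_congr rfl fun μ _ => h i μ

end Boundary

/-! ### The multisymplectic identity on one element -/

section Elements

variable {m n : ℕ} {T : Geometry.SimplicialComplex ℝ (Space m)}

theorem exists_affineBasis (K : Element T) :
    ∃ b : AffineBasis K.1 ℝ (Space m), K.body = convexHull ℝ (range b) := by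
  have hind := T.indep K.2.1
  refine ⟨⟨Subtype.val, hind, ?_⟩, ?_⟩
  · refine hind.affineSpan_eq_top_iff_card_eq_finrank_add_one.2 ?_
    rw [Fintype.card_coe, K.2.2, finrank_euclideanSpace, Fintype.card_fin]
  · change convexHull ℝ (K.1 : Set (Space m)) = convexHull ℝ (range Subtype.val)
    rw [Subtype.range_coe_subtype]
    rfl

/-- The interior of an element lies in the interior of the triangulated space, and the frontier is
null. This matters because the regularity of `H` is assumed only on `Ω`. -/
theorem ae_mem_domain {Ω : Set (Space m)} (hT : IsTriangulation T Ω) (K : Element T) :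
    ∀ᵐ x ∂vol K.body, x ∈ Ω := by
  have hconv : Convex ℝ K.body := convex_convexHull ℝ _
  have hfr : ∀ᵐ x ∂vol K.body, x ∉ frontier K.body :=
    ae_restrict_of_ae (compl_mem_ae_iff.2 (hconv.addHaar_frontier volume))
  have hcl : IsClosed K.body := (K.1.finite_toSet.isCompact_convexHull (𝕜 := ℝ)).isClosed
  filter_upwards [hfr, ae_restrict_mem hcl.measurableSet] with x hx hxK
  rw [hT.eq_interior]
  refine interior_mono (Geometry.SimplicialComplex.convexHull_subset_space K.2.1) ?_
  by_contra h
  exact hx ⟨subset_closure hxK, h⟩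

variable {X : Spaces T n}

/-- The field `û` lives on the whole skeleton; square integrability on one boundary follows by
monotonicity of the measure. -/
theorem componentsL2_uhat (z : Fields X) (K : Element T) (t : ℝ) :
    ComponentsL2 (surf (frontier K.body)) (z.uhat t).1 :=
  MemLp.componentsL2 ((Lp.memLp (z.uhat t).1).mono_measure
    (Measure.restrict_mono (subset_iUnion (fun K : Element T => frontier K.body) K) le_rfl))

theorem memH1_comp_V (K : Element T) (v : X.V K) (i : Fin n) : MemH1 K.body (comp i v.1) :=
  fun μ => (X.V_H2 K v.1 v.2 i μ).imp fun _ h => h.1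

/-- This is the product rule for the continuous bilinear `pairing`; the inclusions of the finite
element spaces into `L²` are continuous linear, so derivatives pass through them. -/
theorem hasDerivAt_density {z z' : Fields X} {K : Element T} {t : ℝ}
    (hu : DifferentiableAt ℝ (fun s => z.u s K) t) (hp : DifferentiableAt ℝ (fun s => z.p s K) t)
    (hu' : DifferentiableAt ℝ (fun s => z'.u s K) t)
    (hp' : DifferentiableAt ℝ (fun s => z'.p s K) t) :
    HasDerivAt (density z z' K)
      ((pairing K.body (z.u t K).1 (deriv (fun s => z'.p s K) t).1 +
          pairing K.body (deriv (fun s => z.u s K) t).1 (z'.p t K).1) -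
        (pairing K.body (z'.u t K).1 (deriv (fun s => z.p s K) t).1 +
          pairing K.body (deriv (fun s => z'.u s K) t).1 (z.p t K).1)) t := by
  have hV : ∀ {w : Fields X}, DifferentiableAt ℝ (fun s => w.u s K) t →
      HasDerivAt (fun s => (w.u s K).1) (deriv (fun s => w.u s K) t).1 t := fun h =>
    (X.V K).subtypeL.hasFDerivAt.comp_hasDerivAt t h.hasDerivAt
  have hD : ∀ {w : Fields X}, DifferentiableAt ℝ (fun s => w.p s K) t →
      HasDerivAt (fun s => (w.p s K).1) (deriv (fun s => w.p s K) t).1 t := fun h =>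
    (X.Vdual K).subtypeL.hasFDerivAt.comp_hasDerivAt t h.hasDerivAt
  have heq : density z z' K = fun s => pairing K.body (z.u s K).1 (z'.p s K).1 -
      pairing K.body (z'.u s K).1 (z.p s K).1 := funext fun s => omegaZero_eq _ _ _ _
  rw [heq]
  exact ((pairing K.body).hasDerivAt_of_bilinear (fun _ => hV hu) (fun _ => hD hp')).sub
    ((pairing K.body).hasDerivAt_of_bilinear (fun _ => hV hu') (fun _ => hD hp))

theorem rateOfChange_eq {z z' : Fields X} {K : Element T} {t : ℝ}
    (hu : DifferentiableAt ℝ (fun s => z.u s K) t) (hp : DifferentiableAt ℝ (fun s => z.p s K) t)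
    (hu' : DifferentiableAt ℝ (fun s => z'.u s K) t)
    (hp' : DifferentiableAt ℝ (fun s => z'.p s K) t) :
    rateOfChange z z' K t =
      ((∫ x in K.body, ∑ i, (deriv (fun s => z'.p s K) t).1 x i * (z.u t K).1 x i) +
          ∫ x in K.body, ∑ i, (deriv (fun s => z.u s K) t).1 x i * (z'.p t K).1 x i) -
        ((∫ x in K.body, ∑ i, (deriv (fun s => z.p s K) t).1 x i * (z'.u t K).1 x i) +
          ∫ x in K.body, ∑ i, (deriv (fun s => z'.u s K) t).1 x i * (z.p t K).1 x i) := by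
  rw [rateOfChange, integral_eq_integralCLM, (hasDerivAt_density hu hp hu' hp').deriv, map_sub,
    map_add, map_add]
  simp only [integralCLM_pairing]
  simp_rw [mul_comm ((z.u t K).1 _ _), mul_comm ((z'.u t K).1 _ _)]

/-- The sum of the three tested covector terms is the integral of the covector applied to the
fields. -/
theorem WeakEquations.integral_val {z : Fields X} {G : Space m → Phase m n →L[ℝ] ℝ}
    {σhat : Space m → Flx m n} {K : Element T} {t : ℝ} (h : WeakEquations z G σhat K t)
    (z' : Fields X) :
    (∫ x in K.body, G x ((z'.u t K).1 x, 0, 0)) + (∫ x in K.body, G x (0, (z'.p t K).1 x, 0)) +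
        ∫ x in K.body, G x (0, 0, (z'.σ t K).1 x) = ∫ x in K.body, G x (z'.val K t x) := by
  rw [← integral_add' (h.int_v _) (h.int_r _), ← integral_add' ((h.int_v _).add (h.int_r _))
    (h.int_τ _)]
  refine integral_congr_ae (Eventually.of_forall fun x => ?_)
  simp only [Fields.val, Pi.add_apply]
  rw [← map_add, ← map_add]
  simp

theorem WeakEquations.eq_τ' {z : Fields X} {G : Space m → Phase m n →L[ℝ] ℝ}
    {σhat : Space m → Flx m n} {K : Element T} {t : ℝ} (h : WeakEquations z G σhat K t)
    (τ : X.S K) :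
    (∫ x in K.body, G x (0, 0, τ.1 x)) = bdryInt K.body (z.uhat t).1 (traceVec τ.1) -
      ∫ x in K.body, ∑ i, ∑ μ, (z.u t K).1 x i * weakPartial K.body μ (comp (μ, i) τ.1) x := by
  have h1 := h.eq_τ τ
  rw [integral_add (integrable_finsetSum _ fun i _ => integrable_finsetSum _ fun μ _ =>
    integrable_mul_weakPartial _ i _) (h.int_τ τ)] at h1
  linarith

theorem WeakEquations.eq_v' {z : Fields X} {G : Space m → Phase m n →L[ℝ] ℝ}
    {σhat : Space m → Flx m n} {K : Element T} {t : ℝ} (h : WeakEquations z G σhat K t)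
    (v : X.V K) :
    ∫ x in K.body, ∑ i, (deriv (fun s => z.p s K) t).1 x i * v.1 x i =
      (∫ x in K.body, ∑ i, ∑ μ, (z.σ t K).1 x (μ, i) * weakPartial K.body μ (comp i v.1) x) -
        (∫ x in K.body, G x (v.1 x, 0, 0)) - bdryInt K.body (traceVec v.1) σhat := by
  rw [h.eq_v v, integral_sub (integrable_finsetSum _ fun i _ => integrable_finsetSum _ fun μ _ =>
    integrable_mul_weakPartial _ (μ, i) _) (h.int_v v)]

/-- The multisymplectic identity for two solutions of weak equations whose covectors are
symmetric. -/
theorem rateOfChange_eq_bdryWedge {z z' : Fields X} {G G' : Space m → Phase m n →L[ℝ] ℝ}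
    {K : Element T} {τhat τhat' : Space m → Flx m n} {t : ℝ}
    (h : WeakEquations z G τhat K t) (h' : WeakEquations z' G' τhat' K t)
    (hsymm : ∫ x in K.body, G x (z'.val K t x) = ∫ x in K.body, G' x (z.val K t x))
    (hτ : ComponentsL2 (surf (frontier K.body)) τhat)
    (hτ' : ComponentsL2 (surf (frontier K.body)) τhat') :
    rateOfChange z z' K t =
      -bdryWedge K.body (z.uhat t).1 τhat (z'.uhat t).1 τhat' +
        bdryWedge K.body
          (fun x => (z.uhat t).1 x - traceVec (z.u t K).1 x)
          (fun x => τhat x - traceVec (z.σ t K).1 x)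
          (fun x => (z'.uhat t).1 x - traceVec (z'.u t K).1 x)
          (fun x => τhat' x - traceVec (z'.σ t K).1 x) := by
  obtain ⟨b, hb⟩ := exists_affineBasis K
  have hu := componentsL2_uhat z K t
  have hu' := componentsL2_uhat z' K t
  have hv := componentsL2_traceVec (z.u t K).1
  have hv' := componentsL2_traceVec (z'.u t K).1
  have hs := componentsL2_traceVec (z.σ t K).1
  have hs' := componentsL2_traceVec (z'.σ t K).1
  rw [bdryWedge_eq b hb hu hτ hu' hτ', bdryWedge_eq b hb (hu.sub hv) (hτ.sub hs) (hu'.sub hv')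
    (hτ'.sub hs'), bdryInt_sub_sub b hb hu hτ' hv hs', bdryInt_sub_sub b hb hu' hτ hv' hs,
    rateOfChange_eq h.diff_u h.diff_p h'.diff_u h'.diff_p, h.eq_r, h'.eq_r, h.eq_v', h'.eq_v']
  -- Integration by parts is used crosswise, `u` of one variation against `σ` of the other.
  have g1 := integral_traceVec b hb (memH1_comp_V K (z.u t K))
    (fun j => X.S_H1 K _ (z'.σ t K).2 j)
  have g2 := integral_traceVec b hb (memH1_comp_V K (z'.u t K))
    (fun j => X.S_H1 K _ (z.σ t K).2 j)
  -- The symmetry hypothesis is split into its three parts and the `σ` parts are replaced by means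
  -- of `eq_τ'`. What remains is a linear relation among the integrals present.
  rw [← h.integral_val, ← h'.integral_val, h.eq_τ', h'.eq_τ'] at hsymm
  linarith

theorem integral_hessian_symm {Ω : Set (Space m)} (hT : IsTriangulation T Ω) {H : Space m →
    Phase m n → ℝ} (hH : ∀ x ∈ Ω, ContDiff ℝ 2 (H x)) (y z z' : Fields X) (K : Element T) (t : ℝ) :
    ∫ x in K.body, fderiv ℝ (fderiv ℝ (H x)) (y.val K t x) (z.val K t x) (z'.val K t x) =
      ∫ x in K.body, fderiv ℝ (fderiv ℝ (H x)) (y.val K t x) (z'.val K t x) (z.val K t x) := by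
  refine integral_congr_ae ?_
  filter_upwards [ae_mem_domain hT K] with x hx
  exact ((hH x hx).contDiffAt.isSymmSndFDerivAt (by simp)) _ _

end Elements

end HybridDDW

/-! ### The theorem -/

open HybridDDW in
theorem mainTheorem5 {m n : ℕ} {Ω : Set (Space m)}
    {T : Geometry.SimplicialComplex ℝ (Space m)} [Fintype (Element T)]
    (hT : IsTriangulation T Ω) (X : Spaces T n) (t₀ t₁ : ℝ)
    (H : ℝ → Space m → Phase m n → ℝ)
    (hH : ∀ t ∈ Set.Ioo t₀ t₁, ∀ x ∈ Ω, ContDiff ℝ 2 (H t x))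
    (Φ : FluxFunction X) (y : Fields X)
    (hΦ : ∀ t ∈ Set.Ioo t₀ t₁, DifferentiableAt ℝ Φ (y.arg t))
    (K : Element T) (hy : ∀ t ∈ Set.Ioo t₀ t₁, SolvesOn H Φ y K t) :
    (∀ z z' : Fields X, IsVariation H Φ t₀ t₁ y z K → IsVariation H Φ t₀ t₁ y z' K →
      ∀ t ∈ Set.Ioo t₀ t₁,
        DifferentiableAt ℝ (density z z' K) t ∧
        rateOfChange z z' K t = - boundaryFlux Φ y z z' K t + boundaryDefect Φ y z z' K t ∧
        (rateOfChange z z' K t = - boundaryFlux Φ y z z' K t ↔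
          boundaryDefect Φ y z z' K t = 0)) ∧
    ((∀ z z' : Fields X, IsVariation H Φ t₀ t₁ y z K → IsVariation H Φ t₀ t₁ y z' K →
        ∀ t ∈ Set.Ioo t₀ t₁, rateOfChange z z' K t = - boundaryFlux Φ y z z' K t) ↔
      (∀ z z' : Fields X, IsVariation H Φ t₀ t₁ y z K → IsVariation H Φ t₀ t₁ y z' K →
        ∀ t ∈ Set.Ioo t₀ t₁, boundaryDefect Φ y z z' K t = 0)) := by
  have key : ∀ z z' : Fields X, IsVariation H Φ t₀ t₁ y z K → IsVariation H Φ t₀ t₁ y z' K →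
      ∀ t ∈ Set.Ioo t₀ t₁,
        rateOfChange z z' K t = - boundaryFlux Φ y z z' K t + boundaryDefect Φ y z z' K t :=
    fun z z' hz hz' t ht => rateOfChange_eq_bdryWedge (hz t ht) (hz' t ht)
      (integral_hessian_symm hT (hH t ht) y z z' K t) (MemLp.componentsL2 (Lp.memLp _))
      (MemLp.componentsL2 (Lp.memLp _))
  have iff : ∀ z z' : Fields X, IsVariation H Φ t₀ t₁ y z K → IsVariation H Φ t₀ t₁ y z' K →
      ∀ t ∈ Set.Ioo t₀ t₁, (rateOfChange z z' K t = - boundaryFlux Φ y z z' K t ↔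
        boundaryDefect Φ y z z' K t = 0) := fun z z' hz hz' t ht => by
    rw [key z z' hz hz' t ht, add_eq_left]
  refine ⟨fun z z' hz hz' t ht => ⟨?_, key z z' hz hz' t ht, iff z z' hz hz' t ht⟩,
    fun h z z' hz hz' t ht => (iff z z' hz hz' t ht).1 (h z z' hz hz' t ht),
    fun h z z' hz hz' t ht => (iff z z' hz hz' t ht).2 (h z z' hz hz' t ht)⟩
  exact (hasDerivAt_density (hz t ht).diff_u (hz t ht).diff_p (hz' t ht).diff_u
    (hz' t ht).diff_p).differentiableAt
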